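/- Fix an integer $N\ge 1$ and a real $s>0$. Let $\mathbb S_s=\{z\in\mathbb C: -s<\operatorname{Im} z<s\}$ with closure $\overline{\mathbb S}_s$. Let $\mathcal A(\mathbb S_s)$ be the space of complex-valued functions that are analytic on $\mathbb S_s$ and continuous on $\overline{\mathbb S}_s$, and $\mathcal{BA}(\mathbb S_s)$ the subspace of those that are bounded on $\overline{\mathbb S}_s$. Let $\mathrm{Mat}_{<2}(N)$ be the set of real $N\times N$ matrices that are diagonalisable over $\mathbb R$ with all eigenvalues in $(-2,2)$. A real matrix is non-negative if all its entries are $\ge 0$, and irreducible if no permutation of the standard basis makes it block-upper-triangular with two non-empty diagonal blocks. Let $BC(\mathbb R,\mathbb R)$ be the set of bounded continuous functions $\mathbb R\to\mathbb R$. A function $g:\mathbb R\to\mathbb R$ is Hölder continuous if there are $\alpha\in(0,1]$ and $K>0$ with $|g(x)-g(y)|\le K|x-y|^\alpha$ for all $x,y\in\mathbb R$. For $C\in\mathrm{Mat}_{<2}(N)$ put $$\Phi_C(x)=\frac1{2\pi}\int_{-\infty}^{\infty}e^{ikx}\,\bigl(2\cosh(sk)\mathbf 1-C\bigr)^{-1}\,dk\qquad(x\in\mathbb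 R).$$ Let $G\in\mathrm{Mat}_{<2}(N)$ be non-negative and irreducible, and let $a=(a_1,\dots,a_N)$ be continuous functions $\mathbb R\to\mathbb R$ that are bounded below and such that every $e^{-a_n}$ is Hölder continuous. A tuple $A\in\mathcal A(\mathbb S_s)^N$ is called a valid asymptotics if each $A_n$ is real-valued on $\mathbb R$, the functions $e^{-A_n(x)}$ and $\frac{d}{dx}e^{-A_n(x)}$ are bounded on $\mathbb R$, and $A(x+is)+A(x-is)=G\cdot A(x)$ for all $x\in\mathbb R$. **Theorem.** There is $f_\star\in BC(\mathbb R,\mathbb R)^N$ such that the following holds. (i) For every $C\in\mathrm{Mat}_{<2}(N)$, $f_\star$ is the unique solution $f\in BC(\mathbb R,\mathbb R)^N$ of the TBA equation $$f(x)=\int_{-\infty}^{\infty}\Phi_C(x-y)\cdot\Bigl(G\cdot\log\bigl(e^{-a(y)}+e^{f(y)}\bigr)-C\cdot f(y)\Bigr)\,dy\qquad(x\in\mathbb R),$$ where $\log(e^{-a}+e^{f})$ is the vector with components $\log(e^{-a_m}+e^{f_m})$. In particular $f_\star$ does not depend on $C$. (ii) $f_\star$ extends to a function in $\mathcal{BA}(\mathbb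 S_s)^N$, also denoted $f_\star$. If $a$ extends to a valid asymptotics (also denoted $a$), then the functions $Y_n(z)=e^{a_n(z)+f_{\star,n}(z)}$, for $z\in\overline{\mathbb S}_s$ and $n=1,\dots,N$, form the unique tuple $Y\in\mathcal A(\mathbb S_s)^N$ that satisfies $$Y_n(x+is)\,Y_n(x-is)=\prod_{m=1}^N\bigl(1+Y_m(x)\bigr)^{G_{nm}}\qquad(x\in\mathbb R,\ n=1,\dots,N)$$ and, for every $n$: (1) $Y_n(\mathbb R)\subseteq\mathbb R_{>0}$; (2) $Y_n(z)\ne0$ for all $z\in\overline{\mathbb S}_s$; (3) $\log Y_n-a_n\in\mathcal{BA}(\mathbb S_s)$, where $\log Y_n$ is any continuous logarithm of $Y_n$ on $\overline{\mathbb S}_s$ (the condition does not depend on its choice). -/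

import Mathlib

open scoped Matrix BoundedContinuousFunction NNReal

noncomputable section

namespace TBA

/-- Real matrices that are diagonalisable over `ℝ`, with all eigenvalues in `(-2, 2)`. -/
def MatLtTwo {N : ℕ} (C : Matrix (Fin N) (Fin N) ℝ) : Prop :=
  ∃ (P : (Matrix (Fin N) (Fin N) ℝ)ˣ) (d : Fin N → ℝ),
    (∀ i, -2 < d i ∧ d i < 2) ∧
      C = (P : Matrix (Fin N) (Fin N) ℝ) * Matrix.diagonal d *
        ((P⁻¹ : (Matrix (Fin N) (Fin N) ℝ)ˣ) : Matrix (Fin N) (Fin N) ℝ)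

/-- All entries are non-negative. -/
def NonNegative {N : ℕ} (G : Matrix (Fin N) (Fin N) ℝ) : Prop :=
  ∀ i j, 0 ≤ G i j

/-- Irreducibility: no permutation of the standard basis makes `G` block-upper-triangular (with two
nonempty diagonal blocks). The surjective map `b` records which basis vectors go to the first and
which to the second block. Every `1 × 1` matrix is irreducible in this sense, the zero matrix
included. -/
def Irreducible {N : ℕ} (G : Matrix (Fin N) (Fin N) ℝ) : Prop :=
  ∀ b : Fin N → Fin 2, Function.Surjective b → ¬ G.BlockTriangular b

/-- Real functions that are Hölder continuous on `ℝ`, for some exponent in `(0, 1]`. -/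
def IsHolder (g : ℝ → ℝ) : Prop :=
  ∃ K α : ℝ≥0, 0 < α ∧ α ≤ 1 ∧ HolderWith K α g

/-- The open strip `-s < Im z < s`. -/
def strip (s : ℝ) : Set ℂ := {z | -s < z.im ∧ z.im < s}

/-- Analytic on the open strip and continuous on its closure. Only the values of `f` on the closed
strip matter. -/
def MemA (s : ℝ) (f : ℂ → ℂ) : Prop := DiffContOnCl ℂ f (strip s)

/-- Functions as in `MemA` that are bounded on the closed strip. -/
def MemBA (s : ℝ) (f : ℂ → ℂ) : Prop :=
  MemA s f ∧ ∃ B : ℝ, ∀ z ∈ closure (strip s), ‖f z‖ ≤ B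

/-- The kernel `Φ_C(x) = (1 / 2π) ∫ e^{ikx} (2 cosh(sk) 1 - C)⁻¹ dk`, taken entrywise. -/
def Phi {N : ℕ} (s : ℝ) (C : Matrix (Fin N) (Fin N) ℝ) (x : ℝ) : Matrix (Fin N) (Fin N) ℂ :=
  fun n m => (1 / (2 * (Real.pi : ℂ))) *
    ∫ k : ℝ, Complex.exp (Complex.I * (k : ℂ) * (x : ℂ)) *
      ((((2 * Real.cosh (s * k)) • (1 : Matrix (Fin N) (Fin N) ℝ) - C)⁻¹ n m : ℝ) : ℂ)

/-- The convolution of a matrix-valued function with a vector-valued function. -/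
def conv {N : ℕ} (F : ℝ → Matrix (Fin N) (Fin N) ℂ) (g : ℝ → Fin N → ℂ) (x : ℝ) : Fin N → ℂ :=
  fun n => ∫ y : ℝ, (F (x - y) *ᵥ g y) n

/-- The vector `G · log (e^{-a(y)} + e^{f(y)}) - C · f(y)`. -/
def source {N : ℕ} (G C : Matrix (Fin N) (Fin N) ℝ) (a f : Fin N → ℝ → ℝ) (y : ℝ) : Fin N → ℝ :=
  G *ᵥ (fun m => Real.log (Real.exp (-a m y) + Real.exp (f m y))) - C *ᵥ (fun m => f m y)

/-- `f = Φ_C ⋆ (G · log (e^{-a} + e^f) - C · f)` on `ℝ`. -/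
def IsTBASolution {N : ℕ} (s : ℝ) (G C : Matrix (Fin N) (Fin N) ℝ) (a f : Fin N → ℝ → ℝ) : Prop :=
  ∀ (x : ℝ) (n : Fin N),
    (f n x : ℂ) = conv (Phi s C) (fun y m => (source G C a f y m : ℂ)) x n

/-- Valid asymptotics for the Y-system with matrix `G`. -/
structure ValidAsymptotics {N : ℕ} (s : ℝ) (G : Matrix (Fin N) (Fin N) ℝ)
    (A : Fin N → ℂ → ℂ) : Prop where
  memA : ∀ n, MemA s (A n)
  real : ∀ n (x : ℝ), (A n x).im = 0
  bounded : ∀ n, ∃ B : ℝ, ∀ x : ℝ, ‖Complex.exp (-A n x)‖ ≤ B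
  deriv_bounded : ∀ n, ∃ B : ℝ, ∀ x : ℝ, ‖deriv (fun t : ℝ => Complex.exp (-A n t)) x‖ ≤ B
  linear : ∀ n (x : ℝ),
    A n (x + Complex.I * s) + A n (x - Complex.I * s) = ∑ m, (G n m : ℂ) * A m x

/-- Solutions of the Y-system in `𝓐(𝕊_s)` that are positive on `ℝ`, have no zeros on the closed
strip, and have the asymptotics `A`, that is, `log Y_n - A_n` is bounded on the closed strip. By
positivity, the powers in `ysystem` are powers of positive real numbers. In `asymptotics`, `h` is a
logarithm of `Y_n` on the closed strip. -/
structure IsYSolution {N : ℕ} (s : ℝ) (G : Matrix (Fin N) (Fin N) ℝ)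
    (A Y : Fin N → ℂ → ℂ) : Prop where
  memA : ∀ n, MemA s (Y n)
  ysystem : ∀ n (x : ℝ),
    Y n (x + Complex.I * s) * Y n (x - Complex.I * s) = ∏ m, (1 + Y m x) ^ (G n m : ℂ)
  positive : ∀ n (x : ℝ), ∃ r : ℝ, 0 < r ∧ Y n x = r
  no_roots : ∀ n, ∀ z ∈ closure (strip s), Y n z ≠ 0
  asymptotics : ∀ n, ∃ h : ℂ → ℂ, MemA s h ∧
    (∀ z ∈ closure (strip s), Complex.exp (h z) = Y n z) ∧ MemBA s (fun z => h z - A n z)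

end TBA

end

/-!
# TBA equations and Y-systems

Write `φ_0` for the function `kernel s`, that is `φ_0(z) = 1 / (4 s cosh (π z / 2s))`, which is
positive on the real line with integral `1/2`, and `L(f)` for the vector `log (e^{-a} + e^f)`.

*Reduction to `C = 0`.* After diagonalising `C`, the resolvent identity
`(2 cosh - C)⁻¹ = (2 cosh)⁻¹ + (2 cosh)⁻¹ C (2 cosh - C)⁻¹` (`phi_resolvent`) and associativity of
convolution show that, for bounded `f` and `g`, the equations `f = Φ_C ⋆ (g - C f)` and
`f = φ_0 ⋆ g` are equivalent (`eq_conv_Phi_iff`). The TBA equation is therefore `f = φ_0 ⋆ G L(f)` for every `C`.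

*Existence and uniqueness.* The map `f ↦ L(f)` is `1`-Lipschitz in every component, so
`f ↦ φ_0 ⋆ G L(f)` has Lipschitz matrix `G / 2`. The vector `w = (1 - G/2)⁻¹ 1` (`exists_weight`) is
bounded below by `1` and satisfies `G w / 2 = w - 1`, so the map is a contraction in the supremum
norm weighted by `w` (`exists_unique_fixedPoint`).

*Analytic extension.* For bounded Hölder continuous `g` the convolution `φ_0 ⋆ g` is holomorphic on
the open strip, and equals `g(x) / 2 + ∫ φ_0(u + i t) (g(x - u) - g(x)) du` at `x + i t`. The
integrand is dominated by an integrable function of `u` uniformly in `|t| ≤ s`, since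
`|cosh (u + i v)| ≥ |sinh u|`; this gives a bounded continuous extension to the closed strip, and as
the kernel changes sign between the two boundary lines, the boundary values add up to `g`
(`exists_strip_extension`). Applied to `L(f)`, this yields `exists_extension_of_fixedPoint`; applied
to exponentials, it computes the Fourier transform of `φ_0` (`integral_kernel_mul_exp`).

*Uniqueness for the Y-system.* Conversely, a bounded function `D` on the closed strip satisfies
`D = φ_0 ⋆ (D(· + i s) + D(· - i s))` on the real line (`eq_kconv_boundary`, by Cauchy's theorem).
For a solution `Y` of the Y-system and `D = log Y - A`, the boundary sum is `G L(Re D)` up to a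
constant in `2πi ℤ`, so `Re D` is the solution of the TBA equation (`IsYSolution.eqOn_exp`).
-/

namespace TBA

open MeasureTheory Filter Topology Set

variable {s d : ℝ} {N : ℕ}

/-! ### Hyperbolic functions -/

theorem norm_cosh_sq (u v : ℝ) :
    ‖Complex.cosh (u + v * Complex.I)‖ ^ 2 = Real.sinh u ^ 2 + Real.cos v ^ 2 := by
  rw [Complex.cosh_add, Complex.cosh_mul_I, Complex.sinh_mul_I, Complex.sq_norm,
      ← Complex.ofReal_cosh,
    ← Complex.ofReal_sinh, ← Complex.ofReal_cos, ← Complex.ofReal_sin, Complex.normSq_apply]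
  simp only [Complex.add_re, Complex.add_im, Complex.mul_re, Complex.mul_im, Complex.ofReal_re,
    Complex.ofReal_im, Complex.I_re, Complex.I_im]
  have h1 := Real.cosh_sq u
  have h2 := Real.sin_sq_add_cos_sq v
  ring_nf
  rw [h1]
  linear_combination (Real.sinh u ^ 2) * h2

theorem abs_sinh_le_norm_cosh (u v : ℝ) :
    |Real.sinh u| ≤ ‖Complex.cosh (u + v * Complex.I)‖ := by
  refine abs_le_of_sq_le_sq ?_ (norm_nonneg _)
  rw [norm_cosh_sq]
  nlinarith [sq_nonneg (Real.cos v)]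

theorem abs_cos_mul_cosh_le_norm_cosh (u v : ℝ) :
    |Real.cos v| * Real.cosh u ≤ ‖Complex.cosh (u + v * Complex.I)‖ := by
  refine abs_le_of_sq_le_sq' ?_ (norm_nonneg _) |>.2
  rw [norm_cosh_sq, mul_pow, sq_abs, Real.cosh_sq]
  nlinarith [sq_nonneg (Real.sinh u), Real.cos_sq_le_one v]

theorem norm_sinh_sq (u v : ℝ) :
    ‖Complex.sinh (u + v * Complex.I)‖ ^ 2 = Real.sinh u ^ 2 + Real.sin v ^ 2 := by
  rw [Complex.sinh_add, Complex.cosh_mul_I, Complex.sinh_mul_I, Complex.sq_norm,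
      ← Complex.ofReal_cosh,
    ← Complex.ofReal_sinh, ← Complex.ofReal_cos, ← Complex.ofReal_sin, Complex.normSq_apply]
  simp only [Complex.add_re, Complex.add_im, Complex.mul_re, Complex.mul_im, Complex.ofReal_re,
    Complex.ofReal_im, Complex.I_re, Complex.I_im]
  have h1 := Real.cosh_sq u
  have h2 := Real.sin_sq_add_cos_sq v
  ring_nf
  rw [h1]
  linear_combination (Real.sinh u ^ 2) * h2

theorem norm_sinh_le_cosh (u v : ℝ) :
    ‖Complex.sinh (u + v * Complex.I)‖ ≤ Real.cosh u := by
  refine abs_le_of_sq_le_sq' ?_ (Real.cosh_pos u).le |>.2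
  rw [norm_sinh_sq, Real.cosh_sq]
  linarith [Real.sin_sq_le_one v]

theorem one_add_sq_div_two_le_cosh (x : ℝ) : 1 + x ^ 2 / 2 ≤ Real.cosh x := by
  have h := Real.cosh_two_mul (x / 2)
  have h1 := Real.cosh_sq (x / 2)
  have h2 : |x / 2| ≤ |Real.sinh (x / 2)| := by
    rw [Real.abs_sinh]
    exact Real.self_le_sinh_iff.2 (abs_nonneg _)
  have h3 := sq_le_sq.2 h2
  rw [show 2 * (x / 2) = x by ring] at h
  nlinarith

theorem integrable_inv_cosh {c : ℝ} (hc : c ≠ 0) :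
    Integrable fun x : ℝ => (Real.cosh (c * x))⁻¹ := by
  have key : Integrable fun x : ℝ => (Real.cosh x)⁻¹ := by
    refine (integrable_inv_one_add_sq.const_mul 2).mono' ?_ (ae_of_all _ fun x => ?_)
    · exact (Real.continuous_cosh.inv₀ fun x => (Real.cosh_pos x).ne').aestronglyMeasurable
    · rw [Real.norm_of_nonneg (inv_nonneg.2 (Real.cosh_pos x).le),
        show 2 * (1 + x ^ 2)⁻¹ = ((1 + x ^ 2) / 2)⁻¹ by field_simp]
      apply inv_anti₀ (by positivity)
      have := one_add_sq_div_two_le_cosh x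
      linarith
  exact key.comp_mul_left' hc

theorem integral_inv_cosh : ∫ x : ℝ, (Real.cosh x)⁻¹ = Real.pi := by
  have hd : ∀ x : ℝ, HasDerivAt (fun x => Real.arctan (Real.sinh x)) ((Real.cosh x)⁻¹) x := by
    intro x
    convert (Real.hasDerivAt_sinh x).arctan using 1
    rw [add_comm, ← Real.cosh_sq]
    have := Real.cosh_pos x
    field_simp
  have hi := integrable_inv_cosh one_ne_zero
  simp only [one_mul] at hi
  have ht : Tendsto Real.sinh atTop atTop :=
    tendsto_atTop_mono' _ ((eventually_ge_atTop 0).mono fun x hx => Real.self_le_sinh_iff.2 hx)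
      tendsto_id
  have hb : Tendsto Real.sinh atBot atBot :=
    tendsto_atBot_mono' _ ((eventually_le_atBot 0).mono fun x hx => Real.sinh_le_self_iff.2 hx)
      tendsto_id
  rw [integral_of_hasDerivAt_of_tendsto hd hi
    ((Real.tendsto_arctan_atBot.mono_right nhdsWithin_le_nhds).comp hb)
    ((Real.tendsto_arctan_atTop.mono_right nhdsWithin_le_nhds).comp ht)]
  ring

theorem cosh_le_exp_mul_cosh (a b : ℝ) : Real.cosh a ≤ Real.exp |a - b| * Real.cosh b := by
  rw [Real.cosh_eq, Real.cosh_eq]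
  have h1 : Real.exp a ≤ Real.exp |a - b| * Real.exp b := by
    rw [← Real.exp_add]; apply Real.exp_le_exp.2; linarith [le_abs_self (a - b)]
  have h2 : Real.exp (-a) ≤ Real.exp |a - b| * Real.exp (-b) := by
    rw [← Real.exp_add]; apply Real.exp_le_exp.2; linarith [neg_abs_le (a - b)]
  linarith

/-! ### The kernel on the strip -/

/-- The kernel `1 / (4 s cosh (π z / 2s))`, the inverse Fourier transform of `1 / (2 cosh (s k))`.
It is holomorphic on the open strip; on its closure it has poles at `± i s`, where Lean's division
returns `0`. -/
noncomputable def kernel (s : ℝ) (z : ℂ) : ℂ :=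
  1 / (4 * s * Complex.cosh ((Real.pi / (2 * s) : ℝ) * z))

/-- The complex derivative of `kernel` on the open strip. -/
noncomputable def kernelDeriv (s : ℝ) (z : ℂ) : ℂ :=
  -((Real.pi / (2 * s) : ℝ) * Complex.sinh ((Real.pi / (2 * s) : ℝ) * z)) /
    (4 * s * Complex.cosh ((Real.pi / (2 * s) : ℝ) * z) ^ 2)


theorem ofReal_mul_eq_re_add_im (c : ℝ) (z : ℂ) :
    (c : ℂ) * z = (c * z.re : ℝ) + (c * z.im : ℝ) * Complex.I := by
  conv_lhs => rw [← Complex.re_add_im z]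
  push_cast; ring

theorem cos_pos_of_mem_strip (hs : 0 < s) {t : ℝ} (h1 : -s < t) (h2 : t < s) :
    0 < Real.cos (Real.pi / (2 * s) * t) := by
  have hp := Real.pi_pos
  apply Real.cos_pos_of_mem_Ioo
  constructor
  · rw [show -(Real.pi / 2) = Real.pi / (2 * s) * (-s) by field_simp]; gcongr
  · rw [show (Real.pi / 2) = Real.pi / (2 * s) * s by field_simp]; gcongr

theorem cosh_ne_zero_of_mem_strip (hs : 0 < s) {z : ℂ} (hz : z ∈ strip s) :
    Complex.cosh ((Real.pi / (2 * s) : ℝ) * z) ≠ 0 := by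
  rw [ofReal_mul_eq_re_add_im, ← norm_pos_iff]
  refine lt_of_lt_of_le ?_ (abs_cos_mul_cosh_le_norm_cosh _ _)
  exact mul_pos (abs_pos.2 (cos_pos_of_mem_strip hs hz.1 hz.2).ne') (Real.cosh_pos _)

theorem hasDerivAt_kernel (hs : 0 < s) {z : ℂ} (hz : z ∈ strip s) :
    HasDerivAt (kernel s) (kernelDeriv s z) z := by
  have h0 := cosh_ne_zero_of_mem_strip hs hz
  have h1 : HasDerivAt (fun z : ℂ => 4 * s * Complex.cosh ((Real.pi / (2 * s) : ℝ) * z))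
      (4 * s * (Complex.sinh ((Real.pi / (2 * s) : ℝ) * z) * (Real.pi / (2 * s) : ℝ))) z := by
    apply HasDerivAt.const_mul
    apply HasDerivAt.ccosh
    simpa using (hasDerivAt_id z).const_mul ((Real.pi / (2 * s) : ℝ) : ℂ)
  have hs' : (s : ℂ) ≠ 0 := by exact_mod_cast hs.ne'
  have h2 := (hasDerivAt_const z (1 : ℂ)).div h1 (by simp [h0, hs', -Complex.ofReal_div])
  refine h2.congr_deriv ?_
  unfold kernelDeriv
  field_simp
  ring

theorem norm_kernel_le (hs : 0 < s) {z : ℂ} (hz : z ∈ strip s) :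
    ‖kernel s z‖ ≤ (4 * s * Real.cos (Real.pi / (2 * s) * z.im))⁻¹ *
      (Real.cosh (Real.pi / (2 * s) * z.re))⁻¹ := by
  have hc := cos_pos_of_mem_strip hs hz.1 hz.2
  have h := abs_cos_mul_cosh_le_norm_cosh (Real.pi / (2 * s) * z.re) (Real.pi / (2 * s) * z.im)
  rw [← ofReal_mul_eq_re_add_im, abs_of_pos hc] at h
  unfold kernel
  rw [norm_div, norm_mul, norm_mul, norm_one, Complex.norm_real, Real.norm_of_nonneg hs.le, one_div,
    ← mul_inv]
  have hch := Real.cosh_pos (Real.pi / (2 * s) * z.re)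
  apply inv_anti₀ (by positivity)
  simp only [Complex.norm_ofNat]
  calc _ = 4 * s *
        (Real.cos (Real.pi / (2 * s) * z.im) * Real.cosh (Real.pi / (2 * s) * z.re)) := by
        ring
    _ ≤ _ := by gcongr

theorem norm_kernelDeriv_le (hs : 0 < s) {z : ℂ} (hz : z ∈ strip s) :
    ‖kernelDeriv s z‖ ≤ Real.pi / (8 * s ^ 2 * Real.cos (Real.pi / (2 * s) * z.im) ^ 2) *
      (Real.cosh (Real.pi / (2 * s) * z.re))⁻¹ := by
  have hc := cos_pos_of_mem_strip hs hz.1 hz.2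
  have hp := Real.pi_pos
  have h := abs_cos_mul_cosh_le_norm_cosh (Real.pi / (2 * s) * z.re) (Real.pi / (2 * s) * z.im)
  have h' := norm_sinh_le_cosh (Real.pi / (2 * s) * z.re) (Real.pi / (2 * s) * z.im)
  rw [← ofReal_mul_eq_re_add_im] at h h'
  rw [abs_of_pos hc] at h
  unfold kernelDeriv
  rw [norm_div, norm_neg, norm_mul, norm_mul, norm_mul, norm_pow, Complex.norm_real,
    Complex.norm_real, Real.norm_of_nonneg hs.le, Real.norm_of_nonneg (by positivity)]
  have hch := Real.cosh_pos (Real.pi / (2 * s) * z.re)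
  simp only [Complex.norm_ofNat]
  calc _ ≤ Real.pi / (2 * s) * Real.cosh (Real.pi / (2 * s) * z.re) /
        (4 * s *
          (Real.cos (Real.pi / (2 * s) * z.im) * Real.cosh (Real.pi / (2 * s) * z.re)) ^ 2) := by
        gcongr
    _ = _ := by
      generalize Real.cos (Real.pi / (2 * s) * z.im) = p at hc ⊢
      generalize Real.cosh (Real.pi / (2 * s) * z.re) = q at hch ⊢
      field_simp
      norm_num

/-- Away from the imaginary axis the kernel is bounded uniformly in the imaginary part, up to and
including the boundary of the strip. -/
theorem norm_kernel_le_inv_sinh (hs : 0 < s) (u t : ℝ) (hu : u ≠ 0) :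
    ‖kernel s (u + t * Complex.I)‖ ≤ (4 * s * |Real.sinh (Real.pi / (2 * s) * u)|)⁻¹ := by
  have hp := Real.pi_pos
  have h := abs_sinh_le_norm_cosh (Real.pi / (2 * s) * u) (Real.pi / (2 * s) * t)
  have h0 : Real.sinh (Real.pi / (2 * s) * u) ≠ 0 := by
    rw [Ne, Real.sinh_eq_zero]; positivity
  unfold kernel
  rw [norm_div, norm_mul, norm_mul, norm_one, Complex.norm_real, Real.norm_of_nonneg hs.le, one_div]
  apply inv_anti₀ (by positivity)
  simp only [Complex.norm_ofNat]
  gcongr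
  refine h.trans (le_of_eq ?_)
  congr 2; push_cast; ring

theorem continuousAt_kernel_of_ne (hs : 0 < s) (u t : ℝ) (hu : u ≠ 0) :
    ContinuousAt (kernel s) (u + t * Complex.I) := by
  have hp := Real.pi_pos
  have h := abs_sinh_le_norm_cosh (Real.pi / (2 * s) * u) (Real.pi / (2 * s) * t)
  have h0 : Real.sinh (Real.pi / (2 * s) * u) ≠ 0 := by
    rw [Ne, Real.sinh_eq_zero]; positivity
  have h1 : Complex.cosh ((Real.pi / (2 * s) : ℝ) * (u + t * Complex.I)) ≠ 0 := by
    rw [← norm_pos_iff]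
    refine lt_of_lt_of_le (abs_pos.2 h0) (h.trans (le_of_eq ?_))
    congr 2; push_cast; ring
  have hs' : (s : ℂ) ≠ 0 := by exact_mod_cast hs.ne'
  unfold kernel
  apply ContinuousAt.div continuousAt_const
  · exact (Continuous.mul continuous_const
      (Complex.continuous_cosh.comp (continuous_const.mul continuous_id))).continuousAt
  · simp [h1, hs', -Complex.ofReal_div]

/-- By antiperiodicity of `cosh`, the boundary values of the kernel on the two lines are opposite.
At the poles both terms have the value `0`. -/
theorem kernel_boundary_cancel (hs : 0 < s) (u : ℂ) :
    kernel s (u + s * Complex.I) + kernel s (u - s * Complex.I) = 0 := by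
  have hs' : (s : ℂ) ≠ 0 := by exact_mod_cast hs.ne'
  have h : Complex.cosh ((Real.pi / (2 * s) : ℝ) * (u + s * Complex.I)) =
      - Complex.cosh ((Real.pi / (2 * s) : ℝ) * (u - s * Complex.I)) := by
    rw [← Complex.cosh_add_pi_mul_I]
    congr 1; push_cast; field_simp; ring
  unfold kernel
  rw [h, mul_neg, div_neg, neg_add_cancel]

theorem kernel_ofReal (x : ℝ) :
    kernel s x = ((1 / (4 * s * Real.cosh (Real.pi / (2 * s) * x)) : ℝ) : ℂ) := by
  unfold kernel; push_cast; rfl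

theorem measurable_kernel : Measurable (kernel s) := by
  unfold kernel
  apply Measurable.div measurable_const
  exact (Continuous.mul continuous_const
      (Complex.continuous_cosh.comp (continuous_const.mul continuous_id))).measurable

theorem ofReal_mem_strip (hs : 0 < s) (x : ℝ) : (x : ℂ) ∈ strip s := by simp [strip, hs]

theorem isOpen_strip : IsOpen (strip s) :=
  (isOpen_lt continuous_const Complex.continuous_im).inter
    (isOpen_lt Complex.continuous_im continuous_const)

theorem closure_strip (hs : 0 < s) : closure (strip s) = {z | -s ≤ z.im ∧ z.im ≤ s} := by
  have h : strip s = Complex.im ⁻¹' Ioo (-s) s := rfl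
  rw [h, Complex.closure_preimage_im, closure_Ioo (by linarith)]
  rfl

theorem add_I_mul_mem_closure (hs : 0 < s) (x : ℝ) :
    (x + Complex.I * s : ℂ) ∈ closure (strip s) := by
  rw [closure_strip hs]; simp; linarith

theorem sub_I_mul_mem_closure (hs : 0 < s) (x : ℝ) :
    (x - Complex.I * s : ℂ) ∈ closure (strip s) := by
  rw [closure_strip hs]; simp; linarith

theorem isPreconnected_strip : IsPreconnected (strip s) := by
  have h : Convex ℝ (strip s) := (convex_halfSpace_im_gt _).inter (convex_halfSpace_im_lt _)
  exact h.isPreconnected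

theorem integral_kernel_real (hs : 0 < s) : ∫ y : ℝ, kernel s y = 1 / 2 := by
  have hp := Real.pi_pos
  simp only [kernel_ofReal]
  rw [integral_complex_ofReal]
  have : ∀ y : ℝ, 1 / (4 * s * Real.cosh (Real.pi / (2 * s) * y)) =
      (1 / (4 * s)) * (Real.cosh (Real.pi / (2 * s) * y))⁻¹ := by
    intro y; rw [one_div, mul_inv, one_div]
  simp only [this]
  rw [integral_const_mul, Measure.integral_comp_mul_left (fun y => (Real.cosh y)⁻¹),
      integral_inv_cosh,
    abs_of_pos (by positivity), smul_eq_mul]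
  rw [show 1 / (4 * s) * ((Real.pi / (2 * s))⁻¹ * Real.pi) = 1 / 2 by field_simp; norm_num]
  norm_num

theorem continuous_kernel_line (hs : 0 < s) {z : ℂ} (hz : z ∈ strip s) :
    Continuous fun y : ℝ => kernel s (z - y) := by
  rw [continuous_iff_continuousAt]
  intro y
  refine ContinuousAt.comp (g := kernel s) (f := fun y : ℝ => z - y) ?_ (by fun_prop)
  exact (hasDerivAt_kernel hs (by simpa [strip] using hz)).continuousAt

theorem integrable_kernel_line (hs : 0 < s) {z : ℂ} (hz : z ∈ strip s) :
    Integrable fun y : ℝ => kernel s (z - y) := by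
  have hp := Real.pi_pos
  have hi := ((integrable_inv_cosh (c := Real.pi / (2 * s)) (by positivity)).comp_sub_left
    z.re).const_mul (4 * s * Real.cos (Real.pi / (2 * s) * z.im))⁻¹
  refine hi.mono' (continuous_kernel_line hs hz).aestronglyMeasurable (ae_of_all _ fun y => ?_)
  simpa using norm_kernel_le hs (z := z - y) (by simpa [strip] using hz)

/-! ### Convolution with the kernel -/

/-- Convolution of the kernel with a function on the real line, as a function of a complex
variable. The integral is the intended one for `z` in the open strip. -/
noncomputable def kconv (s : ℝ) (g : ℝ → ℂ) (z : ℂ) : ℂ := ∫ y : ℝ, kernel s (z - y) * g y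

theorem integrable_kernel_mul (hs : 0 < s) {g : ℝ → ℂ} (hg : Measurable g) {B : ℝ}
    (hB : ∀ x, ‖g x‖ ≤ B) {z : ℂ} (hz : z ∈ strip s) :
    Integrable fun y : ℝ => kernel s (z - y) * g y :=
  (integrable_kernel_line hs hz).mul_bdd hg.aestronglyMeasurable (ae_of_all _ hB)

theorem measurable_kernelDeriv : Measurable (kernelDeriv s) := by
  unfold kernelDeriv
  apply Measurable.div
  · exact (Continuous.neg (Continuous.mul continuous_const
      (Complex.continuous_sinh.comp (continuous_const.mul continuous_id)))).measurable
  · exact (Continuous.mul continuous_const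
      ((Complex.continuous_cosh.comp (continuous_const.mul continuous_id)).pow 2)).measurable

/-- Convolutions with the kernel are holomorphic on the open strip. -/
theorem hasDerivAt_kconv (hs : 0 < s) {g : ℝ → ℂ} (hg : Measurable g) {B : ℝ}
    (hB : ∀ x, ‖g x‖ ≤ B) {z : ℂ} (hz : z ∈ strip s) :
    HasDerivAt (kconv s g) (∫ y : ℝ, kernelDeriv s (z - y) * g y) z := by
  have hp := Real.pi_pos
  set c := Real.pi / (2 * s) with hc
  have hc0 : 0 < c := by positivity
  -- on `|Im w| < r` with `r < s` the kernel and its derivative decay uniformly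
  obtain ⟨r, hr1, hr2⟩ := exists_between (abs_lt.2 hz)
  have hr0 : 0 < r := (abs_nonneg _).trans_lt hr1
  set m := Real.cos (c * r) with hm
  have hm0 : 0 < m := cos_pos_of_mem_strip hs (by linarith) hr2
  have hcr : c * r ≤ Real.pi := by
    have : c * r ≤ c * s := by gcongr
    have h2 : c * s = Real.pi / 2 := by rw [hc]; field_simp
    linarith
  have hmem : ∀ᶠ w in 𝓝 z, |w.im| < r ∧ |w.re - z.re| < 1 := by
    apply Filter.Eventually.and
    · exact (Complex.continuous_im.abs.tendsto z).eventually_lt_const hr1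
    · have h : Continuous fun w : ℂ => |w.re - z.re| := by fun_prop
      refine (h.tendsto z).eventually_lt_const ?_
      simp
  have hstrip : ∀ w : ℂ, |w.im| < r → ∀ y : ℝ, w - y ∈ strip s := by
    intro w hw y
    have := abs_lt.1 hw
    simp only [strip, mem_ofPred_eq, Complex.sub_im, Complex.ofReal_im, sub_zero]
    constructor <;> linarith
  have hi : Integrable fun y : ℝ => Real.pi / (8 * s ^ 2 * m ^ 2) * (Real.exp c *
      (Real.cosh (c * (z.re - y)))⁻¹) * B :=
    ((((integrable_inv_cosh hc0.ne').comp_sub_left z.re).const_mul _).const_mul _).mul_const _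
  refine (hasDerivAt_integral_of_dominated_loc_of_deriv_le (μ := volume) (𝕜 := ℂ) (E := ℂ)
    (F := fun w (y : ℝ) => kernel s (w - y) * g y)
    (F' := fun w (y : ℝ) => kernelDeriv s (w - y) * g y)
    (s := {w : ℂ | |w.im| < r ∧ |w.re - z.re| < 1}) hmem ?_ ?_ ?_ ?_ hi ?_).2
  · refine Eventually.of_forall fun w => Measurable.aestronglyMeasurable ?_
    exact (measurable_kernel.comp (by fun_prop)).mul hg
  · exact integrable_kernel_mul hs hg hB hz
  · exact Measurable.aestronglyMeasurable ((measurable_kernelDeriv.comp (by fun_prop)).mul hg)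
  · refine ae_of_all _ fun y w hw => ?_
    rw [norm_mul]
    refine mul_le_mul ?_ (hB y) (norm_nonneg _) (by positivity)
    refine (norm_kernelDeriv_le hs (hstrip w hw.1 y)).trans ?_
    simp only [Complex.sub_im, Complex.ofReal_im, sub_zero, Complex.sub_re, Complex.ofReal_re,
      ← hc]
    have h1 : m ≤ Real.cos (c * w.im) := by
      rw [hm, ← Real.cos_abs (c * w.im), abs_mul, abs_of_pos hc0]
      apply Real.cos_le_cos_of_nonneg_of_le_pi (by positivity) hcr
      gcongr
      exact hw.1.le
    have h2 := cosh_le_exp_mul_cosh (c * (z.re - y)) (c * (w.re - y))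
    have h3 : |c * (z.re - y) - c * (w.re - y)| ≤ c := by
      rw [← mul_sub, abs_mul, abs_of_pos hc0, sub_sub_sub_cancel_right, abs_sub_comm]
      nlinarith [hw.2.le]
    have h4 : Real.cosh (c * (z.re - y)) ≤ Real.exp c * Real.cosh (c * (w.re - y)) := by
      refine h2.trans ?_
      have := Real.cosh_pos (c * (w.re - y))
      gcongr
    have h5 := Real.cosh_pos (c * (w.re - y))
    have h6 := Real.cosh_pos (c * (z.re - y))
    gcongr
    rw [← div_eq_mul_inv, le_div_iff₀ h6, inv_mul_le_iff₀ h5]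
    linarith
  · refine ae_of_all _ fun y w hw => ?_
    apply HasDerivAt.mul_const
    have := (hasDerivAt_kernel hs (hstrip w hw.1 y)).comp w ((hasDerivAt_id w).sub_const (y : ℂ))
    simpa using! this

/-- Functions holomorphic on the strip are determined by their values on the real line. -/
theorem eqOn_strip_of_eq_on_real (hs : 0 < s) {f g : ℂ → ℂ} (hf : DifferentiableOn ℂ f (strip s))
    (hg : DifferentiableOn ℂ g (strip s)) (h : ∀ x : ℝ, f x = g x) : EqOn f g (strip s) := by
  refine (hf.analyticOnNhd isOpen_strip).eqOn_of_preconnected_of_frequently_eq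
    (hg.analyticOnNhd isOpen_strip) isPreconnected_strip (z₀ := 0)
    (by simpa using ofReal_mem_strip hs 0) ?_
  have ht : Tendsto (fun n : ℕ => ((1 / ((n : ℝ) + 1) : ℝ) : ℂ)) atTop (𝓝[≠] 0) := by
    rw [tendsto_nhdsWithin_iff]
    constructor
    · have := (Complex.continuous_ofReal.tendsto 0).comp tendsto_one_div_add_atTop_nhds_zero_nat
      rwa [Complex.ofReal_zero] at this
    · refine Eventually.of_forall fun n => ?_
      simp only [mem_compl_iff, mem_singleton_iff, Complex.ofReal_eq_zero]
      positivity
  exact ht.frequently (Frequently.of_forall fun n => h _)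

theorem MemA.eqOn_closure (hs : 0 < s) {f g : ℂ → ℂ} (hf : MemA s f) (hg : MemA s g)
    (h : ∀ x : ℝ, f x = g x) : EqOn f g (closure (strip s)) :=
  (eqOn_strip_of_eq_on_real hs hf.1 hg.1 h).of_subset_closure hf.2 hg.2 subset_closure subset_rfl

/-- The integral of the kernel along horizontal lines is holomorphic in the strip and constant on
the real line, hence constant. -/
theorem integral_kernel_sub (hs : 0 < s) {z : ℂ} (hz : z ∈ strip s) :
    ∫ y : ℝ, kernel s (z - y) = 1 / 2 := by
  have hd : DifferentiableOn ℂ (kconv s fun _ => 1) (strip s) := fun w hw =>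
    (hasDerivAt_kconv hs measurable_const (B := 1)
        (by simp) hw).differentiableAt.differentiableWithinAt
  have hreal : ∀ x : ℝ, kconv s (fun _ => 1) x = 1 / 2 := by
    intro x
    unfold kconv
    simp only [mul_one, ← Complex.ofReal_sub]
    rw [integral_sub_left_eq_self (fun y : ℝ => kernel s y), integral_kernel_real hs]
  have h := eqOn_strip_of_eq_on_real hs hd (differentiableOn_const (1 / 2)) hreal hz
  simpa [kconv] using h

theorem cosh_le_mul_abs_sinh {c u : ℝ} (hc : 0 < c) (hu : 1 ≤ |u|) :
    Real.cosh (c * u) ≤ Real.cosh c / Real.sinh c * |Real.sinh (c * u)| := by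
  have h0 : 0 < Real.sinh c := Real.sinh_pos_iff.2 hc
  rw [Real.abs_sinh, ← Real.cosh_abs (c * u), abs_mul, abs_of_pos hc, div_mul_eq_mul_div,
    le_div_iff₀ h0]
  have h1 : 0 ≤ Real.sinh (c * |u| - c) := Real.sinh_nonneg_iff.2 (by nlinarith)
  rw [Real.sinh_sub] at h1
  linarith

/-- The singularity of the kernel on the boundary of the strip becomes integrable after
multiplication with the modulus of continuity of a bounded Hölder continuous function. -/
theorem exists_integrable_bound {c α : ℝ} (hc : 0 < c) (hα : 0 < α) (K B : ℝ) (hK : 0 ≤ K)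
    (hB : 0 ≤ B) :
    ∃ D : ℝ → ℝ, Integrable D ∧ ∀ u : ℝ, u ≠ 0 → ∀ q : ℝ, q ≤ K * |u| ^ α → q ≤ B →
      |Real.sinh (c * u)|⁻¹ * q ≤ D u := by
  have h0 : 0 < Real.sinh c := Real.sinh_pos_iff.2 hc
  have h0' := Real.cosh_pos c
  refine ⟨fun u => (Icc (-1) 1).indicator (fun u => c⁻¹ * K * |u| ^ (α - 1)) u +
    Real.cosh c / Real.sinh c * B * (Real.cosh (c * u))⁻¹, ?_, ?_⟩
  · refine Integrable.add ?_ ((integrable_inv_cosh hc.ne').const_mul _)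
    rw [integrable_indicator_iff measurableSet_Icc]
    refine Integrable.const_mul ?_ _
    change IntegrableOn (fun u : ℝ => |u| ^ (α - 1)) (Icc (-1) 1) volume
    rw [← intervalIntegrable_iff_integrableOn_Icc_of_le (by norm_num)]
    refine intervalIntegrable_of_even (fun x => by rw [abs_neg]) fun x hx => ?_
    refine (intervalIntegral.intervalIntegrable_rpow' (r := α - 1) (by linarith)).congr ?_
    intro y hy
    rw [uIoc_of_le hx.le] at hy
    simp only [abs_of_pos hy.1]
  · intro u hu q h1 h2
    have hcosh := Real.cosh_pos (c * u)
    have hsinh : 0 < |Real.sinh (c * u)| := by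
      rw [abs_pos, Ne, Real.sinh_eq_zero]; positivity
    beta_reduce
    by_cases hu1 : |u| ≤ 1
    · have hmem : u ∈ Icc (-1 : ℝ) 1 := abs_le.1 hu1
      rw [indicator_of_mem hmem]
      have hupos := abs_pos.2 hu
      have h3 : c * |u| ≤ |Real.sinh (c * u)| := by
        rw [Real.abs_sinh, abs_mul, abs_of_pos hc]
        exact Real.self_le_sinh_iff.2 (by positivity)
      have h4 : |Real.sinh (c * u)|⁻¹ * q ≤ c⁻¹ * K * |u| ^ (α - 1) := by
        rw [Real.rpow_sub_one hupos.ne', inv_mul_le_iff₀ hsinh]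
        calc q ≤ K * |u| ^ α := h1
          _ = c * |u| * (c⁻¹ * K * (|u| ^ α / |u|)) := by field_simp
          _ ≤ _ := by gcongr
      have h5 : 0 ≤ Real.cosh c / Real.sinh c * B * (Real.cosh (c * u))⁻¹ := by positivity
      linarith
    · rw [indicator_of_notMem (show u ∉ Icc (-1 : ℝ) 1 from fun h => hu1 (abs_le.2 h)), zero_add]
      have h3 := cosh_le_mul_abs_sinh hc (not_le.1 hu1).le
      rw [inv_mul_le_iff₀ hsinh]
      calc q ≤ B := h2
        _ = Real.cosh (c * u) * (B * (Real.cosh (c * u))⁻¹) := by field_simp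
        _ ≤ Real.cosh c / Real.sinh c * |Real.sinh (c * u)| * (B * (Real.cosh (c * u))⁻¹) := by
          gcongr
        _ = _ := by ring

/-- The convolution of the kernel with a bounded Hölder continuous function `g` extends to a bounded
function on the closed strip, whose boundary values add up to `g`. -/
theorem exists_strip_extension (hs : 0 < s) {g : ℝ → ℂ} {B K α : ℝ} (hα : 0 < α)
    (hB : ∀ x, ‖g x‖ ≤ B) (hH : ∀ x y, ‖g x - g y‖ ≤ K * |x - y| ^ α) :
    ∃ F : ℂ → ℂ, MemBA s F ∧ (∀ z ∈ strip s, F z = kconv s g z) ∧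
      ∀ x : ℝ, F (x + Complex.I * s) + F (x - Complex.I * s) = g x := by
  have hp := Real.pi_pos
  have hK : 0 ≤ K := by
    have := (norm_nonneg _).trans (hH 1 0)
    simpa using this
  have hB0 : 0 ≤ B := (norm_nonneg _).trans (hB 0)
  have hgc : Continuous g := by
    rw [continuous_iff_continuousAt]
    intro x
    rw [ContinuousAt, tendsto_iff_norm_sub_tendsto_zero]
    refine squeeze_zero (fun _ => norm_nonneg _) (fun y => hH y x) ?_
    have h : Continuous fun y : ℝ => K * |y - x| ^ α :=
      continuous_const.mul (Continuous.rpow_const (by fun_prop) fun y => Or.inr hα.le)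
    have := h.tendsto x
    simpa [Real.zero_rpow hα.ne'] using! this
  have hae : ∀ᵐ u : ℝ, u ≠ 0 := Measure.ae_ne volume 0
  obtain ⟨D, hDi, hD⟩ := exists_integrable_bound (c := Real.pi / (2 * s)) (by positivity) hα K
    (B + B) hK (by positivity)
  -- the subtracted form of the convolution, which makes sense up to the boundary
  set J : ℂ → ℝ → ℂ := fun z u => kernel s (u + z.im * Complex.I) * (g (z.re - u) - g z.re) with hJ
  have hJb : ∀ z : ℂ, ∀ u : ℝ, u ≠ 0 → ‖J z u‖ ≤ (4 * s)⁻¹ * D u := by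
    intro z u hu
    have h1 : ‖g (z.re - u) - g z.re‖ ≤ K * |u| ^ α := by simpa using hH (z.re - u) z.re
    have h2 : ‖g (z.re - u) - g z.re‖ ≤ B + B := (norm_sub_le _ _).trans (add_le_add (hB _) (hB _))
    have h3 := hD u hu _ h1 h2
    rw [hJ, norm_mul]
    calc _ ≤ (4 * s * |Real.sinh (Real.pi / (2 * s) * u)|)⁻¹ * ‖g (z.re - u) - g z.re‖ := by
          gcongr; exact norm_kernel_le_inv_sinh hs _ _ hu
      _ = (4 * s)⁻¹ * (|Real.sinh (Real.pi / (2 * s) * u)|⁻¹ * ‖g (z.re - u) - g z.re‖) := by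
          rw [mul_inv]; ring
      _ ≤ _ := by gcongr
  have hJm : ∀ z, AEStronglyMeasurable (J z) volume := fun z =>
    ((measurable_kernel.comp (by fun_prop)).mul (by fun_prop)).aestronglyMeasurable
  have hDi' := hDi.const_mul (4 * s)⁻¹
  have hJint : ∀ z, Integrable (J z) := fun z =>
    hDi'.mono' (hJm z) (hae.mono fun u hu => hJb z u hu)
  have hcont : Continuous fun z : ℂ => g z.re / 2 + ∫ u, J z u := by
    refine Continuous.add (by fun_prop) ?_
    refine continuous_of_dominated hJm (fun z => hae.mono fun u hu => hJb z u hu) hDi' ?_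
    refine hae.mono fun u hu => ?_
    refine Continuous.mul ?_ (by fun_prop)
    rw [continuous_iff_continuousAt]
    intro z
    exact ContinuousAt.comp (g := kernel s) (f := fun z : ℂ => (u : ℂ) + z.im * Complex.I)
      (continuousAt_kernel_of_ne hs u z.im hu) (by fun_prop)
  have hstrip : ∀ z ∈ strip s, g z.re / 2 + ∫ u, J z u = kconv s g z := by
    intro z hz
    have hz' : (z.im * Complex.I : ℂ) ∈ strip s := by simpa [strip] using hz
    have e1 : kconv s g z = ∫ u : ℝ, kernel s (u + z.im * Complex.I) * g (z.re - u) := by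
      unfold kconv
      rw [← integral_sub_left_eq_self (fun y : ℝ => kernel s (z - y) * g y) volume z.re]
      refine integral_congr_ae (ae_of_all _ fun u => ?_)
      dsimp only
      congr 2
      push_cast; linear_combination -Complex.re_add_im z
    have e2 : ∫ u : ℝ, kernel s (u + z.im * Complex.I) * g z.re = g z.re / 2 := by
      have h : ∫ u : ℝ, kernel s (u + z.im * Complex.I) = 1 / 2 := by
        rw [← integral_kernel_sub hs hz,
          ← integral_sub_left_eq_self (fun y : ℝ => kernel s (z - y)) volume z.re]
        refine integral_congr_ae (ae_of_all _ fun u => ?_)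
        dsimp only
        congr 1
        push_cast; linear_combination Complex.re_add_im z
      rw [integral_mul_const, h]
      ring
    have hi2 : Integrable fun u : ℝ => kernel s (u + z.im * Complex.I) * g z.re := by
      refine Integrable.mul_const ?_ _
      have := (integrable_kernel_line hs hz').comp_neg
      simpa [add_comm] using! this
    rw [← e2, e1, ← integral_add hi2 (hJint z)]
    refine integral_congr_ae (ae_of_all _ fun u => ?_)
    simp only [hJ]; ring
  refine ⟨_, ⟨⟨?_, hcont.continuousOn⟩, B / 2 + ∫ u, (4 * s)⁻¹ * D u, ?_⟩, hstrip, ?_⟩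
  · intro z hz
    have h := (hasDerivAt_kconv hs hgc.measurable hB hz).differentiableAt
    exact h.differentiableWithinAt.congr hstrip (hstrip z hz)
  · intro z _
    refine (norm_add_le _ _).trans (add_le_add ?_ ?_)
    · rw [norm_div, Complex.norm_ofNat]
      gcongr
      exact hB _
    · exact norm_integral_le_of_norm_le hDi' (hae.mono fun u hu => hJb z u hu)
  · intro x
    have h : (∫ u, J (x + Complex.I * s) u) + ∫ u, J (x - Complex.I * s) u = 0 := by
      rw [← integral_add (hJint _) (hJint _), ← integral_zero ℝ ℂ]
      refine integral_congr_ae (ae_of_all _ fun u => ?_)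
      have := kernel_boundary_cancel hs u
      simp only [hJ]
      simp only [Complex.add_re, Complex.sub_re, Complex.ofReal_re, Complex.mul_re, Complex.I_re,
        Complex.I_im, Complex.ofReal_im, Complex.add_im, Complex.sub_im, Complex.mul_im]
      rw [show (x + (0 * s - 1 * 0) : ℝ) = x by ring, show (x - (0 * s - 1 * 0) : ℝ) = x by ring,
        ← add_mul]
      rw [show ((0 + (0 * 0 + 1 * s) : ℝ) : ℂ) = s by push_cast; ring,
        show ((0 - (0 * 0 + 1 * s) : ℝ) : ℂ) = -s by push_cast; ring, neg_mul, ← sub_eq_add_neg,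
            this,
        zero_mul]
    have e1 : (x + Complex.I * s : ℂ).re = x := by simp
    have e2 : (x - Complex.I * s : ℂ).re = x := by simp
    rw [e1, e2]
    linear_combination h

/-- The Fourier transform of the kernel, from the strip extension of an exponential: the boundary
values of `c e^{ikz}` add up to `e^{ikx}`, which determines `c`. -/
theorem integral_kernel_mul_exp (hs : 0 < s) (k x : ℝ) :
    ∫ y : ℝ, kernel s (x - y) * Complex.exp (Complex.I * k * y) =
      Complex.exp (Complex.I * k * x) / (2 * Real.cosh (s * k)) := by
  obtain ⟨F, hF, hF1, hF2⟩ := exists_strip_extension hs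
    (g := fun y => Complex.exp (Complex.I * k * y))
    (B := 1) (K := |k|) (α := 1) one_pos
    (fun y => by
      rw [Complex.norm_exp]; simp)
    (fun y y' => by
      rw [Real.rpow_one, ← abs_mul]
      have h1 : Complex.exp (Complex.I * k * y) - Complex.exp (Complex.I * k * y') =
        Complex.exp (Complex.I * (k * y' : ℝ)) *
          (Complex.exp (Complex.I * (k * (y - y') : ℝ)) - 1) := by
        rw [mul_sub, ← Complex.exp_add, mul_one]
        congr 2 <;> (push_cast; ring_nf)
      rw [h1, norm_mul, Complex.norm_exp_I_mul_ofReal, one_mul]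
      exact Real.norm_exp_I_mul_ofReal_sub_one_le)
  -- convolution commutes with translations, so the extension is a multiple of the exponential
  set c := kconv s (fun y => Complex.exp (Complex.I * k * y)) 0 with hc
  have hreal : ∀ x : ℝ, F x = c * Complex.exp (Complex.I * k * x) := by
    intro x
    rw [hF1 x (ofReal_mem_strip hs x), hc, kconv, kconv, ← integral_add_right_eq_self _ x,
      ← integral_mul_const]
    refine integral_congr_ae (ae_of_all _ fun u => ?_)
    dsimp only
    rw [mul_assoc (kernel _ _), ← Complex.exp_add]
    congr 2 <;> (push_cast; ring)
  have hd : Differentiable ℂ fun z : ℂ => c * Complex.exp (Complex.I * k * z) := by fun_prop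
  have h2 := hF.1.eqOn_closure hs hd.diffContOnCl hreal
  have h3 := hF2 x
  rw [h2 (add_I_mul_mem_closure hs x), h2 (sub_I_mul_mem_closure hs x)] at h3
  have hch : (2 * Real.cosh (s * k) : ℂ) ≠ 0 := by
    have := Real.cosh_pos (s * k)
    exact_mod_cast (by positivity : (2 * Real.cosh (s * k)) ≠ 0)
  have h4 : c * (2 * Real.cosh (s * k)) = 1 := by
    have he := Complex.exp_ne_zero (Complex.I * k * x)
    apply mul_right_cancel₀ he
    push_cast
    rw [Complex.two_cosh]
    have e1 : Complex.exp (Complex.I * k * (x + Complex.I * s)) =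
        Complex.exp (-(s * k)) * Complex.exp (Complex.I * k * x) := by
      rw [← Complex.exp_add]; congr 1
      linear_combination (k * s : ℂ) * Complex.I_sq
    have e2 : Complex.exp (Complex.I * k * (x - Complex.I * s)) =
        Complex.exp (s * k) * Complex.exp (Complex.I * k * x) := by
      rw [← Complex.exp_add]; congr 1
      linear_combination (-k * s : ℂ) * Complex.I_sq
    beta_reduce at h3
    rw [e1, e2] at h3
    linear_combination h3
  have h5 := hreal x
  rw [hF1 x (ofReal_mem_strip hs x)] at h5
  rw [eq_div_iff hch]
  change kconv s _ x * _ = _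
  rw [h5]
  linear_combination Complex.exp (Complex.I * k * x) * h4

/-! ### Representation by boundary values -/

theorem sinh_ne_zero_of_mem_closure (hs : 0 < s) {z : ℂ} (hz : z ∈ closure (strip s)) (h0 : z ≠ 0) :
    Complex.sinh ((Real.pi / (2 * s) : ℝ) * z) ≠ 0 := by
  have hp := Real.pi_pos
  rw [closure_strip hs] at hz
  intro h
  rw [ofReal_mul_eq_re_add_im] at h
  have h1 := norm_sinh_sq (Real.pi / (2 * s) * z.re) (Real.pi / (2 * s) * z.im)
  rw [h, norm_zero] at h1
  have hq1 := sq_nonneg (Real.sinh (Real.pi / (2 * s) * z.re))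
  have hq2 := sq_nonneg (Real.sin (Real.pi / (2 * s) * z.im))
  have h2 : Real.sinh (Real.pi / (2 * s) * z.re) = 0 := by nlinarith
  have h3 : Real.sin (Real.pi / (2 * s) * z.im) = 0 := by nlinarith
  have hc : 0 < Real.pi / (2 * s) := by positivity
  have h4 : z.re = 0 := by simpa [hc.ne'] using Real.sinh_eq_zero.1 h2
  have hcs : Real.pi / (2 * s) * s = Real.pi / 2 := by field_simp
  have h5 : Real.pi / (2 * s) * z.im = 0 := by
    refine (Real.sin_eq_zero_iff_of_lt_of_lt ?_ ?_).1 h3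
    · have : Real.pi / (2 * s) * (-s) ≤ Real.pi / (2 * s) * z.im := by gcongr; exact hz.1
      linarith
    · have : Real.pi / (2 * s) * z.im ≤ Real.pi / (2 * s) * s := by gcongr; exact hz.2
      linarith
  have h6 : z.im = 0 := by simpa [hc.ne'] using h5
  exact h0 (Complex.ext h4 h6)

/-- A bounded function on the strip is the convolution of the kernel with the sum of its two
boundary values: integrate `(D z - D x₀) / sinh (π (z - x₀) / 2s)` along the boundary of long
rectangles. -/
theorem eq_kconv_boundary (hs : 0 < s) {D : ℂ → ℂ} (hD : MemBA s D) (x₀ : ℝ) :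
    D x₀ = kconv s (fun y => D (y + Complex.I * s) + D (y - Complex.I * s)) x₀ := by
  have hp := Real.pi_pos
  obtain ⟨⟨hDd, hDc⟩, B, hB⟩ := hD
  set c := Real.pi / (2 * s) with hc
  have hc0 : 0 < c := by positivity
  have hcs : c * s = Real.pi / 2 := by rw [hc]; field_simp
  have hx₀ := ofReal_mem_strip hs x₀
  have hnhds : strip s ∈ 𝓝 (x₀ : ℂ) := isOpen_strip.mem_nhds hx₀
  have hB0 : 0 ≤ B := (norm_nonneg _).trans (hB _ (subset_closure hx₀))
  set S : ℂ → ℂ := fun z => Complex.sinh (c * (z - x₀)) with hS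
  have hSd : ∀ z, HasDerivAt S (c * Complex.cosh (c * (z - x₀))) z := by
    intro z
    have := (((hasDerivAt_id z).sub_const (x₀ : ℂ)).const_mul (c : ℂ)).csinh
    simp only [id, mul_one] at this
    rwa [mul_comm] at this
  have hSdiff : Differentiable ℂ S := fun z => (hSd z).differentiableAt
  have hS0 : S x₀ = 0 := by simp [hS]
  have hne : ∀ z ∈ closure (strip s), z ≠ x₀ → S z ≠ 0 := by
    intro z hz hzx
    refine sinh_ne_zero_of_mem_closure hs ?_ (sub_ne_zero.2 hzx)
    rw [closure_strip hs] at hz ⊢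
    simpa using hz
  have hdne : ∀ z ∈ closure (strip s), dslope S x₀ z ≠ 0 := by
    intro z hz
    by_cases hzx : z = x₀
    · rw [hzx, dslope_same, (hSd x₀).deriv]
      simp [hc0.ne']
    · rw [dslope_of_ne _ hzx, slope_def_field, hS0, sub_zero]
      exact div_ne_zero (hne z hz hzx) (sub_ne_zero.2 hzx)
  -- the quotient `(D z - D x₀) / sinh (c (z - x₀))`, with the removable singularity filled in
  set H : ℂ → ℂ := fun z => dslope D x₀ z / dslope S x₀ z with hH
  have hHeq : ∀ z : ℂ, z ≠ x₀ → H z = (D z - D x₀) / S z := by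
    intro z hzx
    have : z - (x₀ : ℂ) ≠ 0 := sub_ne_zero.2 hzx
    rw [hH]
    dsimp only
    rw [dslope_of_ne _ hzx, dslope_of_ne _ hzx, slope_def_field, slope_def_field, hS0, sub_zero]
    field_simp
  have hHd : DifferentiableOn ℂ H (strip s) :=
    ((Complex.differentiableOn_dslope hnhds).2 hDd).div
      ((Complex.differentiableOn_dslope hnhds).2 hSdiff.differentiableOn)
      fun z hz => hdne z (subset_closure hz)
  have hnhds' := mem_of_superset hnhds (subset_closure (s := strip s))
  have hHc : ContinuousOn H (closure (strip s)) :=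
    ((continuousOn_dslope hnhds').2 ⟨hDc, hDd.differentiableAt hnhds⟩).div
      ((continuousOn_dslope hnhds').2 ⟨hSdiff.continuous.continuousOn, hSdiff _⟩) hdne
  set g : ℝ → ℂ := fun y => D (y + Complex.I * s) + D (y - Complex.I * s) with hg
  set k : ℝ → ℂ := fun y => kernel s (x₀ - y) * (g y - 2 * D x₀) with hk
  have hup := add_I_mul_mem_closure hs
  have hdown := sub_I_mul_mem_closure hs
  have hgc : Continuous g := by
    refine Continuous.add ?_ ?_
    · exact hDc.comp_continuous (by fun_prop) hup
    · exact hDc.comp_continuous (by fun_prop) hdown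
  have hgB : ∀ y, ‖g y‖ ≤ B + B := fun y =>
    (norm_add_le _ _).trans (add_le_add (hB _ (hup y)) (hB _ (hdown y)))
  have hkg := integrable_kernel_mul hs hgc.measurable hgB hx₀
  have hkl := (integrable_kernel_line hs hx₀).mul_const (2 * D x₀)
  have hki : Integrable k := by
    simp only [hk, mul_sub]
    exact hkg.sub hkl
  -- on the two boundary lines, `sinh` becomes `± i cosh`
  have hline : ∀ y : ℝ, H (y + (-s : ℝ) * Complex.I) - H (y + (s : ℝ) * Complex.I) =
      4 * s * Complex.I * k y := by
    intro y
    have hsI : (s : ℂ) ≠ 0 := by exact_mod_cast hs.ne'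
    have e1 : (c : ℂ) * (Complex.I * s) = Real.pi / 2 * Complex.I := by
      rw [mul_left_comm, ← Complex.ofReal_mul, hcs]; push_cast; ring
    have hSu : S (y + Complex.I * s) = Complex.I * Complex.cosh (c * (x₀ - y)) := by
      simp only [hS]
      rw [show (c : ℂ) * (y + Complex.I * s - x₀) = -(c * (x₀ - y)) + Real.pi / 2 * Complex.I by
        rw [← e1]; ring]
      rw [Complex.sinh_add, Complex.cosh_mul_I, Complex.sinh_mul_I, Complex.cos_pi_div_two,
        Complex.sin_pi_div_two, Complex.cosh_neg]
      ring
    have hSd : S (y - Complex.I * s) = -(Complex.I * Complex.cosh (c * (x₀ - y))) := by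
      simp only [hS]
      rw [show (c : ℂ) * (y - Complex.I * s - x₀) = -(c * (x₀ - y) + Real.pi / 2 * Complex.I) by
        rw [← e1]; ring]
      rw [Complex.sinh_neg, Complex.sinh_add, Complex.cosh_mul_I, Complex.sinh_mul_I,
        Complex.cos_pi_div_two, Complex.sin_pi_div_two]
      ring
    have hch : Complex.cosh (c * (x₀ - y)) ≠ 0 := by
      rw [← Complex.ofReal_sub, ← Complex.ofReal_mul, ← Complex.ofReal_cosh]
      exact_mod_cast (Real.cosh_pos _).ne'
    have hn1 : (y + Complex.I * s : ℂ) ≠ x₀ := fun h => by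
      have := congrArg Complex.im h; simp [hs.ne'] at this
    have hn2 : (y - Complex.I * s : ℂ) ≠ x₀ := fun h => by
      have := congrArg Complex.im h; simp [hs.ne'] at this
    rw [show (y + (-s : ℝ) * Complex.I : ℂ) = y - Complex.I * s by push_cast; ring,
      show (y + (s : ℝ) * Complex.I : ℂ) = y + Complex.I * s by ring, hHeq _ hn2, hHeq _ hn1, hSu,
          hSd]
    simp only [hk, hg, kernel, ← hc]
    field_simp
    linear_combination (-(D (y - Complex.I * s) + D (y + Complex.I * s) - 2 * D x₀)) * Complex.I_sq
  have hside : ∀ R : ℝ, R ≠ 0 → ‖∫ y : ℝ in (-s)..s, H ((x₀ + R : ℝ) + y * Complex.I)‖ ≤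
      (B + B) / Real.sinh (c * |R|) * (2 * s) := by
    intro R hR
    have := intervalIntegral.norm_integral_le_of_norm_le_const (a := -s) (b := s)
      (f := fun y : ℝ => H ((x₀ + R : ℝ) + y * Complex.I)) (C := (B + B) / Real.sinh (c * |R|)) ?_
    · rwa [show |s - -s| = 2 * s by rw [sub_neg_eq_add, abs_of_pos (by positivity)]; ring] at this
    intro y hy
    rw [uIoc_of_le (by linarith)] at hy
    have hmem : ((x₀ + R : ℝ) + y * Complex.I : ℂ) ∈ closure (strip s) := by
      rw [closure_strip hs]; simp [hy.1.le, hy.2]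
    have hn : ((x₀ + R : ℝ) + y * Complex.I : ℂ) ≠ x₀ := fun h => by
      have := congrArg Complex.re h; simp [hR] at this
    rw [hHeq _ hn, norm_div]
    have hsp : 0 < Real.sinh (c * |R|) := Real.sinh_pos_iff.2 (by positivity)
    gcongr
    · exact (norm_sub_le _ _).trans (add_le_add (hB _ hmem) (hB _ (subset_closure hx₀)))
    · have h1 := norm_sinh_sq (c * R) (c * y)
      refine abs_le_of_sq_le_sq' ?_ (norm_nonneg _) |>.2
      simp only [hS]
      rw [show (c : ℂ) * ((x₀ + R : ℝ) + y * Complex.I - x₀) =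
          (c * R : ℝ) + (c * y : ℝ) * Complex.I by
        push_cast; ring, h1, ← abs_of_pos hc0, ← abs_mul, ← Real.abs_sinh, sq_abs, abs_of_pos hc0]
      nlinarith [sq_nonneg (Real.sin (c * y))]
  have hrect : ∀ R : ℝ, 0 < R → ‖∫ y in (x₀ - R)..(x₀ + R), 4 * s * Complex.I * k y‖ ≤
      2 * ((B + B) / Real.sinh (c * R) * (2 * s)) := by
    intro R hR
    have h := Complex.integral_boundary_rect_eq_zero_of_continuousOn_of_differentiableOn H
      ⟨x₀ - R, -s⟩ ⟨x₀ + R, s⟩ (hHc.mono ?_) (hHd.mono ?_)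
    rotate_left
    · intro z hz
      rw [closure_strip hs]
      have := hz.2
      rwa [mem_preimage, uIcc_of_le (by simp; linarith)] at this
    · intro z hz
      have := hz.2
      rwa [mem_preimage, min_eq_left (by simp; linarith), max_eq_right (by simp; linarith)] at this
    simp only at h
    have hcu : Continuous fun y : ℝ => H (y + (s : ℝ) * Complex.I) :=
      hHc.comp_continuous (by fun_prop) fun y => by simpa [mul_comm] using hup y
    have hcd : Continuous fun y : ℝ => H (y + (-s : ℝ) * Complex.I) :=
      hHc.comp_continuous (by fun_prop) fun y => by
        simpa [mul_comm, sub_eq_add_neg] using hdown y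
    rw [← intervalIntegral.integral_sub (hcd.intervalIntegrable _ _)
      (hcu.intervalIntegrable _ _)] at h
    simp only [hline] at h
    have h1 := hside R hR.ne'
    have h2 := hside (-R) (neg_ne_zero.2 hR.ne')
    rw [abs_neg] at h2
    rw [abs_of_pos hR] at h1 h2
    rw [← sub_eq_add_neg] at h2
    rw [add_sub_assoc, ← smul_sub] at h
    rw [eq_neg_of_add_eq_zero_left h, norm_neg, norm_smul, Complex.norm_I, one_mul, two_mul]
    exact (norm_sub_le _ _).trans (add_le_add h1 h2)
  have hlim1 : Tendsto (fun R : ℝ => ∫ y in (x₀ - R)..(x₀ + R), 4 * s * Complex.I * k y) atTop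
      (𝓝 (∫ y, 4 * s * Complex.I * k y)) := by
    refine intervalIntegral_tendsto_integral (hki.const_mul _) ?_ ?_
    · exact tendsto_atBot_add_const_left _ _ tendsto_neg_atTop_atBot
    · exact tendsto_atTop_add_const_left _ _ tendsto_id
  have hlim2 : Tendsto (fun R : ℝ => 2 * ((B + B) / Real.sinh (c * R) * (2 * s))) atTop (𝓝 0) := by
    have ht : Tendsto (fun R : ℝ => Real.sinh (c * R)) atTop atTop := by
      refine tendsto_atTop_mono' _ ((eventually_ge_atTop 0).mono fun R hR =>
        Real.self_le_sinh_iff.2 (by positivity)) (tendsto_id.const_mul_atTop hc0)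
    simpa using! ((tendsto_const_nhds.div_atTop ht).mul_const (2 * s)).const_mul 2
  have hzero : ∫ y, 4 * s * Complex.I * k y = 0 :=
    tendsto_nhds_unique hlim1
      (squeeze_zero_norm' ((eventually_gt_atTop 0).mono fun R hR => hrect R hR) hlim2)
  rw [integral_const_mul] at hzero
  have hk0 : ∫ y, k y = 0 := by
    have hsI : (s : ℂ) ≠ 0 := by exact_mod_cast hs.ne'
    simpa [hsI] using hzero
  simp only [hk, mul_sub] at hk0
  rw [integral_sub hkg hkl, integral_mul_const, integral_kernel_sub hs hx₀] at hk0
  unfold kconv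
  linear_combination -hk0

/-! ### Scalar TBA kernels -/

/-- The Fourier multiplier `1 / (2 cosh (s k) - d)`. -/
noncomputable def symbol (s d k : ℝ) : ℝ := (2 * Real.cosh (s * k) - d)⁻¹

/-- The scalar TBA kernel, with Fourier transform `symbol s d`. -/
noncomputable def phi (s d x : ℝ) : ℂ :=
  (1 / (2 * (Real.pi : ℂ))) *
    ∫ k : ℝ, Complex.exp (Complex.I * (k : ℂ) * (x : ℂ)) * (symbol s d k : ℂ)

theorem symbol_denom_ge (s d k : ℝ) :
    (2 - |d|) * Real.cosh (s * k) ≤ 2 * Real.cosh (s * k) - d := by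
  nlinarith [le_abs_self d, Real.one_le_cosh (s * k), abs_nonneg d]

theorem symbol_denom_pos (hd : |d| < 2) (k : ℝ) : 0 < 2 * Real.cosh (s * k) - d :=
  (mul_pos (by linarith) (Real.cosh_pos _)).trans_le (symbol_denom_ge s d k)

theorem symbol_pos (hd : |d| < 2) (k : ℝ) : 0 < symbol s d k :=
  inv_pos.2 (symbol_denom_pos hd k)

theorem symbol_le (hd : |d| < 2) (k : ℝ) :
    symbol s d k ≤ (2 - |d|)⁻¹ * (Real.cosh (s * k))⁻¹ := by
  rw [← mul_inv]
  exact inv_anti₀ (mul_pos (by linarith) (Real.cosh_pos _)) (symbol_denom_ge s d k)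

theorem continuous_symbol (hd : |d| < 2) : Continuous (symbol s d) :=
  Continuous.inv₀ (by fun_prop) fun k => (symbol_denom_pos hd k).ne'

theorem integrable_symbol (hs : 0 < s) (hd : |d| < 2) : Integrable (symbol s d) := by
  refine ((integrable_inv_cosh hs.ne').const_mul (2 - |d|)⁻¹).mono'
    (continuous_symbol hd).aestronglyMeasurable (ae_of_all _ fun k => ?_)
  rw [Real.norm_of_nonneg (symbol_pos hd k).le]
  exact symbol_le hd k

/-- The first derivative of the multiplier. -/
noncomputable def symbol' (s d k : ℝ) : ℝ := -(2 * s * Real.sinh (s * k)) * symbol s d k ^ 2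

/-- The second derivative of the multiplier. -/
noncomputable def symbol'' (s d k : ℝ) : ℝ :=
  -(2 * s ^ 2 * Real.cosh (s * k)) * symbol s d k ^ 2 +
    8 * s ^ 2 * Real.sinh (s * k) ^ 2 * symbol s d k ^ 3

theorem hasDerivAt_symbol (hd : |d| < 2) (k : ℝ) : HasDerivAt (symbol s d) (symbol' s d k) k := by
  have h0 := (symbol_denom_pos (s := s) hd k).ne'
  have h1 : HasDerivAt (fun k => 2 * Real.cosh (s * k) - d) (2 * (Real.sinh (s * k) * s)) k := by
    refine HasDerivAt.sub_const d (HasDerivAt.const_mul 2 (HasDerivAt.cosh ?_))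
    simpa using (hasDerivAt_id k).const_mul s
  refine (h1.inv h0).congr_deriv ?_
  unfold symbol' symbol
  field_simp

theorem hasDerivAt_symbol' (hd : |d| < 2) (k : ℝ) :
    HasDerivAt (symbol' s d) (symbol'' s d k) k := by
  have h1 : HasDerivAt (fun k => -(2 * s * Real.sinh (s * k)))
      (-(2 * s * (Real.cosh (s * k) * s))) k := by
    refine HasDerivAt.fun_neg (HasDerivAt.const_mul _ (HasDerivAt.sinh ?_))
    simpa using (hasDerivAt_id k).const_mul s
  refine (h1.mul ((hasDerivAt_symbol hd k).pow 2)).congr_deriv ?_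
  unfold symbol'' symbol'
  simp only [Pi.pow_apply]
  push_cast
  ring

theorem abs_sinh_le_cosh (x : ℝ) : |Real.sinh x| ≤ Real.cosh x := by
  refine abs_le_of_sq_le_sq ?_ (Real.cosh_pos x).le
  rw [Real.cosh_sq]; linarith

theorem integrable_symbol' (hs : 0 < s) (hd : |d| < 2) : Integrable (symbol' s d) := by
  have hδ : 0 < 2 - |d| := by linarith
  have hc := continuous_symbol (s := s) hd
  refine ((integrable_inv_cosh hs.ne').const_mul (2 * s * ((2 - |d|)⁻¹) ^ 2)).mono'
    (Continuous.aestronglyMeasurable ?_) (ae_of_all _ fun k => ?_)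
  · unfold symbol'; fun_prop
  have h1 := symbol_pos (s := s) hd k
  have h2 := symbol_le (s := s) hd k
  have h3 := Real.cosh_pos (s * k)
  unfold symbol'
  rw [norm_mul, norm_neg, norm_mul, norm_pow, Real.norm_of_nonneg h1.le,
    Real.norm_of_nonneg (by positivity), Real.norm_eq_abs]
  calc _ ≤ 2 * s * Real.cosh (s * k) * ((2 - |d|)⁻¹ * (Real.cosh (s * k))⁻¹) ^ 2 := by
        gcongr; exact abs_sinh_le_cosh _
    _ = _ := by field_simp

theorem integrable_symbol'' (hs : 0 < s) (hd : |d| < 2) : Integrable (symbol'' s d) := by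
  have hδ : 0 < 2 - |d| := by linarith
  have hc := continuous_symbol (s := s) hd
  refine ((integrable_inv_cosh hs.ne').const_mul
    (2 * s ^ 2 * ((2 - |d|)⁻¹) ^ 2 + 8 * s ^ 2 * ((2 - |d|)⁻¹) ^ 3)).mono'
    (Continuous.aestronglyMeasurable ?_) (ae_of_all _ fun k => ?_)
  · unfold symbol''; fun_prop
  have h1 := symbol_pos (s := s) hd k
  have h2 := symbol_le (s := s) hd k
  have h3 := Real.cosh_pos (s * k)
  unfold symbol''
  rw [add_mul]
  refine (norm_add_le _ _).trans (add_le_add ?_ ?_)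
  · rw [norm_mul, norm_neg, norm_pow, Real.norm_of_nonneg h1.le,
      Real.norm_of_nonneg (by positivity)]
    calc _ ≤ 2 * s ^ 2 * Real.cosh (s * k) * ((2 - |d|)⁻¹ * (Real.cosh (s * k))⁻¹) ^ 2 := by gcongr
      _ = _ := by field_simp
  · rw [Real.norm_of_nonneg (by positivity), ← sq_abs (Real.sinh _)]
    calc _ ≤ 8 * s ^ 2 * Real.cosh (s * k) ^ 2 * ((2 - |d|)⁻¹ * (Real.cosh (s * k))⁻¹) ^ 3 := by
          gcongr; exact abs_sinh_le_cosh _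
      _ = _ := by field_simp

theorem norm_exp_I_mul_mul (k x : ℝ) : ‖Complex.exp (Complex.I * k * x)‖ = 1 := by
  rw [Complex.norm_exp]; simp

theorem integrable_exp_mul {h : ℝ → ℝ} (hh : Integrable h) (x : ℝ) :
    Integrable fun k : ℝ => Complex.exp (Complex.I * k * x) * (h k : ℂ) :=
  hh.ofReal.bdd_mul (by fun_prop) (ae_of_all _ fun k => (norm_exp_I_mul_mul k x).le)

/-- Two integrations by parts; the resulting decay `O(1 / x²)` makes `phi` integrable. -/
theorem integral_exp_mul_symbol'' (hs : 0 < s) (hd : |d| < 2) (x : ℝ) :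
    ∫ k : ℝ, Complex.exp (Complex.I * k * x) * (symbol'' s d k : ℂ) =
      -x ^ 2 * ∫ k : ℝ, Complex.exp (Complex.I * k * x) * (symbol s d k : ℂ) := by
  have i0 := integrable_exp_mul (integrable_symbol hs hd) x
  have i1 := integrable_exp_mul (integrable_symbol' hs hd) x
  have i2 := integrable_exp_mul (integrable_symbol'' hs hd) x
  have hder : ∀ k : ℝ, HasDerivAt
      (fun k : ℝ => Complex.exp (Complex.I * k * x) * (symbol' s d k : ℂ)
      - Complex.I * x * (Complex.exp (Complex.I * k * x) * (symbol s d k : ℂ)))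
      (Complex.exp (Complex.I * k * x) * (symbol'' s d k : ℂ)
        + x ^ 2 * (Complex.exp (Complex.I * k * x) * (symbol s d k : ℂ))) k := by
    intro k
    have he : HasDerivAt (fun k : ℝ => Complex.exp (Complex.I * k * x))
        (Complex.exp (Complex.I * k * x) * (Complex.I * x)) k := by
      refine HasDerivAt.cexp ?_
      have := ((Complex.ofRealCLM.hasDerivAt (x := k)).const_mul Complex.I).mul_const (x : ℂ)
      simpa using this
    have h0 := (hasDerivAt_symbol (s := s) hd k).ofReal_comp
    have h1 := (hasDerivAt_symbol' (s := s) hd k).ofReal_comp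
    refine ((he.mul h1).sub ((he.mul h0).const_mul (Complex.I * x))).congr_deriv ?_
    linear_combination (-x ^ 2 * Complex.exp (Complex.I * k * x) * symbol s d k : ℂ) * Complex.I_sq
  have := integral_eq_zero_of_hasDerivAt_of_integrable hder (i2.add (i0.const_mul _))
    (i1.sub (i0.const_mul _))
  rw [integral_add i2 (i0.const_mul _), integral_const_mul] at this
  linear_combination this

theorem integrable_phi (hs : 0 < s) (hd : |d| < 2) : Integrable (phi s d) := by
  have hcont : Continuous (phi s d) := by
    unfold phi
    refine continuous_const.mul (continuous_of_dominated (bound := symbol s d) (fun x => ?_)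
      (fun x => ae_of_all _ fun k => ?_) (integrable_symbol hs hd) (ae_of_all _ fun k => ?_))
    · exact (integrable_exp_mul (integrable_symbol hs hd) x).aestronglyMeasurable
    · rw [norm_mul, norm_exp_I_mul_mul, one_mul, Complex.norm_real,
        Real.norm_of_nonneg (symbol_pos hd k).le]
    · fun_prop
  have hbound : ∀ (h : ℝ → ℝ) (x : ℝ), ‖∫ k : ℝ, Complex.exp (Complex.I * k * x) * (h k : ℂ)‖ ≤
      ∫ k, |h k| := by
    intro h x
    refine (norm_integral_le_integral_norm _).trans (le_of_eq ?_)
    refine integral_congr_ae (ae_of_all _ fun k => ?_)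
    dsimp only
    rw [norm_mul, norm_exp_I_mul_mul, one_mul, Complex.norm_real, Real.norm_eq_abs]
  refine (integrable_inv_one_add_sq.const_mul (‖(1 / (2 * (Real.pi : ℂ)))‖ *
    ((∫ k, |symbol s d k|) + ∫ k, |symbol'' s d k|))).mono' hcont.aestronglyMeasurable
    (ae_of_all _ fun x => ?_)
  have h0 := hbound (symbol s d) x
  have h2 := hbound (symbol'' s d) x
  rw [integral_exp_mul_symbol'' hs hd, norm_mul, norm_neg, norm_pow, Complex.norm_real,
    Real.norm_eq_abs, sq_abs] at h2
  unfold phi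
  rw [norm_mul, mul_assoc]
  gcongr
  rw [← div_eq_mul_inv, le_div_iff₀ (by positivity)]
  linarith

/-- The functions `1 / cosh` are Fourier dual to each other, so the kernel with `s` replaced by
`π / (2s)` computes the inverse Fourier transform of `1 / (2 cosh (s k))`. -/
theorem phi_zero (hs : 0 < s) (x : ℝ) : phi s 0 x = kernel s x := by
  have hp := Real.pi_pos
  have hs' : (s : ℂ) ≠ 0 := by exact_mod_cast hs.ne'
  have hpi : (Real.pi : ℂ) ≠ 0 := by exact_mod_cast hp.ne'
  have h := integral_kernel_mul_exp (s := Real.pi / (2 * s)) (by positivity) x 0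
  have e : ∀ y : ℝ, kernel (Real.pi / (2 * s)) ((0 : ℝ) - y) * Complex.exp (Complex.I * x * y) =
      (s / Real.pi : ℂ) * (Complex.exp (Complex.I * y * x) * (symbol s 0 y : ℂ)) := by
    intro y
    rw [← Complex.ofReal_sub, kernel_ofReal, symbol, mul_right_comm Complex.I (y : ℂ)]
    rw [show Real.pi / (2 * (Real.pi / (2 * s))) * (0 - y) = -(s * y) by field_simp; simp,
      Real.cosh_neg, sub_zero]
    have := Real.cosh_pos (s * y)
    have hc : (Real.cosh (s * y) : ℂ) ≠ 0 := by exact_mod_cast this.ne'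
    push_cast at hc ⊢
    field_simp
    norm_num
  simp only [e] at h
  rw [integral_const_mul] at h
  rw [kernel_ofReal]
  unfold phi
  have := Real.cosh_pos (Real.pi / (2 * s) * x)
  have hc : (Real.cosh (Real.pi / (2 * s) * x) : ℂ) ≠ 0 := by exact_mod_cast this.ne'
  rw [show ((∫ k : ℝ, Complex.exp (Complex.I * k * x) * (symbol s 0 k : ℂ))) =
    (Real.pi / s : ℂ) * ((s / Real.pi : ℂ) *
      ∫ k : ℝ, Complex.exp (Complex.I * k * x) * (symbol s 0 k : ℂ))
    by rw [← mul_assoc, show (Real.pi / s : ℂ) * (s / Real.pi) = 1 by field_simp, one_mul], h]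
  rw [Complex.ofReal_zero, mul_zero, Complex.exp_zero]
  rw [Complex.ofReal_div, Complex.ofReal_mul, Complex.ofReal_mul]
  push_cast at hc ⊢
  field_simp
  norm_num

/-- The identity `1 / (2 cosh - d) = 1 / (2 cosh) + d / (2 cosh (2 cosh - d))`, after inverse
Fourier transformation. -/
theorem phi_resolvent (hs : 0 < s) (hd : |d| < 2) (x : ℝ) :
    phi s d x = kernel s x + d * ∫ y : ℝ, kernel s (x - y) * phi s d y := by
  have hx := ofReal_mem_strip hs x
  have hF : ∫ y : ℝ, kernel s (x - y) * phi s d y = (1 / (2 * (Real.pi : ℂ))) *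
      ∫ k : ℝ, Complex.exp (Complex.I * k * x) * ((symbol s 0 k * symbol s d k : ℝ) : ℂ) := by
    have e1 : ∀ y : ℝ, kernel s (x - y) * phi s d y = (1 / (2 * (Real.pi : ℂ))) *
        ∫ k : ℝ, kernel s (x - y) * (Complex.exp (Complex.I * k * y) * (symbol s d k : ℂ)) := by
      intro y
      rw [integral_const_mul, phi]; ring
    simp only [e1]
    rw [integral_const_mul, integral_integral_swap]
    · congr 1
      refine integral_congr_ae (ae_of_all _ fun k => ?_)
      dsimp only
      simp only [← mul_assoc]
      rw [integral_mul_const, integral_kernel_mul_exp hs]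
      simp only [symbol, sub_zero]
      push_cast
      ring
    · have hi := (integrable_kernel_line hs hx).mul_prod (integrable_symbol hs hd).ofReal
      have := hi.bdd_mul (f := fun p : ℝ × ℝ => Complex.exp (Complex.I * p.2 * p.1)) (c := 1)
        (by fun_prop) (ae_of_all _ fun p => (norm_exp_I_mul_mul _ _).le)
      refine this.congr (ae_of_all _ fun p => ?_)
      exact mul_left_comm _ _ _
  have h02 : |(0 : ℝ)| < 2 := by simp
  have i0 := integrable_exp_mul (integrable_symbol hs h02) x
  have hi2 : Integrable fun k => symbol s 0 k * symbol s d k := by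
    refine (integrable_symbol hs hd).bdd_mul (c := 1) (continuous_symbol h02).aestronglyMeasurable
      (ae_of_all _ fun k => ?_)
    rw [Real.norm_of_nonneg (symbol_pos h02 k).le, symbol]
    refine inv_le_one_of_one_le₀ ?_
    linarith [Real.one_le_cosh (s * k)]
  have i1 := integrable_exp_mul hi2 x
  rw [hF, ← phi_zero hs]
  unfold phi
  rw [mul_left_comm, ← mul_add, ← integral_const_mul (d : ℂ), ← integral_add i0 (i1.const_mul _)]
  congr 1
  refine integral_congr_ae (ae_of_all _ fun k => ?_)
  have hk : symbol s d k = symbol s 0 k + d * (symbol s 0 k * symbol s d k) := by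
    have h1 := (symbol_denom_pos (s := s) hd k).ne'
    have h2 := (symbol_denom_pos (s := s) h02 k).ne'
    unfold symbol
    rw [sub_zero] at *
    field_simp
    ring
  have hk' : (symbol s d k : ℂ) = symbol s 0 k + d * ((symbol s 0 k * symbol s d k : ℝ) : ℂ) := by
    exact_mod_cast hk
  dsimp only
  rw [hk']
  push_cast
  ring

/-- Associativity of convolution for two integrable functions and a bounded one. -/
theorem integral_conv_assoc {A B u : ℝ → ℂ} (hA : Integrable A) (hB : Integrable B)
    (hu : Measurable u) {M : ℝ} (hM : ∀ x, ‖u x‖ ≤ M) (x : ℝ) :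
    ∫ y, (∫ w, A (x - y - w) * B w) * u y = ∫ w, A (x - w) * ∫ y, B (w - y) * u y := by
  have e : ∀ y, (∫ w, A (x - y - w) * B w) * u y = ∫ w, A (x - w) * (B (w - y) * u y) := by
    intro y
    rw [← integral_mul_const, ← integral_sub_right_eq_self _ y]
    refine integral_congr_ae (ae_of_all _ fun w => ?_)
    dsimp only
    rw [show x - y - (w - y) = x - w by ring, mul_assoc]
  simp only [e, ← integral_const_mul]
  rw [integral_integral_swap]
  have h := Integrable.convolution_integrand (ContinuousLinearMap.mul ℂ ℂ) (hA.comp_sub_left x)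
    hB.comp_neg
  have h2 := h.mul_bdd (g := fun p : ℝ × ℝ => u p.1) (c := M)
    (hu.comp measurable_fst).aestronglyMeasurable (ae_of_all _ fun p => hM _)
  refine h2.congr (ae_of_all _ fun p => ?_)
  simp [Function.uncurry, mul_assoc]

/-- For bounded functions, the scalar TBA equation does not depend on the parameter `d`:
the resolvent identity gives `φ_d ⋆ u = φ_0 ⋆ u + d φ_0 ⋆ φ_d ⋆ u`, and `φ_0` and `φ_d` commute
under convolution. -/
theorem eq_phi_conv_iff (hs : 0 < s) (hd : |d| < 2) {f g : ℝ → ℂ} (hf : Measurable f)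
    (hg : Measurable g) {M M' : ℝ} (hM : ∀ x, ‖f x‖ ≤ M) (hM' : ∀ x, ‖g x‖ ≤ M') :
    (∀ x : ℝ, f x = ∫ y, phi s d (x - y) * (g y - d * f y)) ↔ ∀ x : ℝ, f x = kconv s g x := by
  have hker : Integrable fun x : ℝ => kernel s x := by
    have := (integrable_kernel_line hs (ofReal_mem_strip hs 0)).comp_neg
    simpa using! this
  have hphi := integrable_phi hs hd
  have ip : ∀ {u : ℝ → ℂ} {B : ℝ}, Measurable u → (∀ x, ‖u x‖ ≤ B) → ∀ x : ℝ,
      Integrable fun y => phi s d (x - y) * u y := fun hu hB x =>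
    (hphi.comp_sub_left x).mul_bdd hu.aestronglyMeasurable (ae_of_all _ hB)
  have ik : ∀ {u : ℝ → ℂ} {B : ℝ}, Measurable u → (∀ x, ‖u x‖ ≤ B) → ∀ x : ℝ,
      Integrable fun y : ℝ => kernel s (x - y) * u y := fun hu hB x =>
    integrable_kernel_mul hs hu hB (ofReal_mem_strip hs x)
  -- the resolvent identity, with the two factors of the convolution in either order
  have r1 : ∀ x : ℝ, phi s d x = kernel s x + d * ∫ w : ℝ, kernel s ((x - w : ℝ)) * phi s d w := by
    intro x; simpa using phi_resolvent hs hd x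
  have r2 : ∀ x : ℝ, phi s d x = kernel s x + d * ∫ w : ℝ, phi s d (x - w) * kernel s w := by
    intro x
    rw [r1 x, ← integral_sub_left_eq_self _ volume x]
    congr 2
    refine integral_congr_ae (ae_of_all _ fun w => ?_)
    dsimp only
    rw [sub_sub_cancel, mul_comm]
  have expand : ∀ (R : ℝ → ℂ), (∀ x : ℝ, phi s d x = kernel s x + d * R x) →
      ∀ {u : ℝ → ℂ} {B : ℝ}, Measurable u → (∀ x, ‖u x‖ ≤ B) → ∀ x : ℝ,
      ∫ y, phi s d (x - y) * u y = kconv s u x + d * ∫ y, R (x - y) * u y := by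
    intro R hR u B hu hB x
    have h1 : ∀ y : ℝ, d * (R (x - y) * u y) = phi s d (x - y) * u y - kernel s (x - y) * u y := by
      intro y; rw [hR (x - y)]; push_cast; ring
    rw [← integral_const_mul]
    simp only [h1]
    rw [integral_sub (ip hu hB x) (ik hu hB x), kconv]
    ring
  constructor
  · intro h x
    have hu : Measurable fun y => g y - d * f y := by fun_prop
    have hB : ∀ y, ‖g y - d * f y‖ ≤ M' + |d| * M := fun y => by
      refine (norm_sub_le _ _).trans (add_le_add (hM' y) ?_)
      rw [norm_mul, Complex.norm_real, Real.norm_eq_abs]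
      gcongr
      exact hM y
    have h1 := expand _ r1 hu hB x
    rw [← h x, integral_conv_assoc hker hphi hu hB] at h1
    simp only [← h] at h1
    have h2 : kconv s (fun y => g y - d * f y) x = kconv s g x - d * kconv s f x := by
      unfold kconv
      rw [← integral_const_mul, ← integral_sub (ik hg hM' x) ((ik hf hM x).const_mul _)]
      refine integral_congr_ae (ae_of_all _ fun y => ?_)
      dsimp only; ring
    rw [h1, h2]
    have h3 : ∫ w : ℝ, kernel s ((x - w : ℝ)) * f w = kconv s f x := by simp [kconv]
    rw [h3]
    ring
  · intro h x
    have h1 := expand _ r2 hg hM' x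
    rw [integral_conv_assoc hphi hker hg hM'] at h1
    have h3 : ∀ w : ℝ, ∫ y : ℝ, kernel s ((w - y : ℝ)) * g y = f w := by
      intro w; rw [h w]; simp [kconv]
    simp only [h3] at h1
    simp only [mul_sub, mul_left_comm _ (d : ℂ)]
    rw [integral_sub (ip hg hM' x) ((ip hf hM x).const_mul _), integral_const_mul, h1, h x]
    ring

/-! ### Independence of the matrix parameter -/

theorem MatLtTwo.exists_diagonalisation {C : Matrix (Fin N) (Fin N) ℝ} (hC : MatLtTwo C) :
    ∃ (P Q : Matrix (Fin N) (Fin N) ℝ) (d : Fin N → ℝ), P * Q = 1 ∧ (∀ i, |d i| < 2) ∧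
      C = P * Matrix.diagonal d * Q := by
  obtain ⟨U, d, hd, hC⟩ := hC
  exact ⟨_, _, d, U.mul_inv, fun i => abs_lt.2 (hd i), hC⟩

theorem inv_resolvent_eq {P Q C : Matrix (Fin N) (Fin N) ℝ} {d : Fin N → ℝ} (hPQ : P * Q = 1)
    (hC : C = P * Matrix.diagonal d * Q) (hd : ∀ i, |d i| < 2) (k : ℝ) :
    ((2 * Real.cosh (s * k)) • (1 : Matrix (Fin N) (Fin N) ℝ) - C)⁻¹ =
      P * Matrix.diagonal (fun i => symbol s (d i) k) * Q := by
  have hQP : Q * P = 1 := mul_eq_one_comm.1 hPQ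
  apply Matrix.inv_eq_right_inv
  have h1 : (2 * Real.cosh (s * k)) • (1 : Matrix (Fin N) (Fin N) ℝ) - C =
      P * Matrix.diagonal (fun i => 2 * Real.cosh (s * k) - d i) * Q := by
    rw [← Matrix.diagonal_sub, Matrix.mul_sub, Matrix.sub_mul, ← hC, ← Matrix.smul_one_eq_diagonal,
      mul_smul_comm, mul_one, smul_mul_assoc, hPQ]
  have h2 : Matrix.diagonal (fun i => 2 * Real.cosh (s * k) - d i) *
      Matrix.diagonal (fun i => symbol s (d i) k) = 1 := by
    rw [Matrix.diagonal_mul_diagonal, ← Matrix.diagonal_one]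
    congr 1
    funext i
    exact mul_inv_cancel₀ (symbol_denom_pos (hd i) k).ne'
  rw [h1]
  calc _ = P * Matrix.diagonal (fun i => 2 * Real.cosh (s * k) - d i) * (Q * P) *
        Matrix.diagonal (fun i => symbol s (d i) k) * Q := by simp only [Matrix.mul_assoc]
    _ = P * (Matrix.diagonal (fun i => 2 * Real.cosh (s * k) - d i) *
        Matrix.diagonal (fun i => symbol s (d i) k)) * Q := by
        rw [hQP, mul_one]; simp only [Matrix.mul_assoc]
    _ = 1 := by rw [h2, mul_one, hPQ]

theorem mul_diagonal_mul_apply {R : Type*} [CommRing R] (P Q : Matrix (Fin N) (Fin N) R)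
    (v : Fin N → R) (n m : Fin N) :
    (P * Matrix.diagonal v * Q) n m = ∑ i, P n i * v i * Q i m := by
  rw [Matrix.mul_apply]
  simp only [Matrix.mul_diagonal]

/-- Diagonalisation of `C` reduces the matrix kernel to the scalar ones. -/
theorem Phi_eq (hs : 0 < s) {P Q C : Matrix (Fin N) (Fin N) ℝ} {d : Fin N → ℝ} (hPQ : P * Q = 1)
    (hC : C = P * Matrix.diagonal d * Q) (hd : ∀ i, |d i| < 2) (x : ℝ) (n m : Fin N) :
    Phi s C x n m = ∑ i, (P n i : ℂ) * phi s (d i) x * (Q i m : ℂ) := by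
  have e : ∀ k : ℝ, Complex.exp (Complex.I * (k : ℂ) * (x : ℂ)) *
      ((((2 * Real.cosh (s * k)) • (1 : Matrix (Fin N) (Fin N) ℝ) - C)⁻¹ n m : ℝ) : ℂ) =
      ∑ i, (P n i * Q i m : ℂ) * (Complex.exp (Complex.I * (k : ℂ) * (x : ℂ)) *
        (symbol s (d i) k : ℂ)) := by
    intro k
    rw [inv_resolvent_eq hPQ hC hd, mul_diagonal_mul_apply]
    push_cast
    rw [Finset.mul_sum]
    exact Finset.sum_congr rfl fun i _ => by ring
  unfold Phi
  simp only [e]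
  rw [integral_finsetSum _ fun i _ =>
      (integrable_exp_mul (integrable_symbol hs (hd i)) x).const_mul _,
    Finset.mul_sum]
  refine Finset.sum_congr rfl fun i _ => ?_
  rw [integral_const_mul, phi]
  ring

theorem norm_mulVec_le (Q : Matrix (Fin N) (Fin N) ℂ) {v : Fin N → ℂ} {M : ℝ}
    (hv : ∀ m, ‖v m‖ ≤ M) (i : Fin N) : ‖(Q *ᵥ v) i‖ ≤ ∑ m, ‖Q i m‖ * M := by
  refine (norm_sum_le Finset.univ fun m => Q i m * v m).trans (Finset.sum_le_sum fun m _ => ?_)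
  rw [norm_mul]
  gcongr
  exact hv m

theorem kconv_mulVec (hs : 0 < s) (Q : Matrix (Fin N) (Fin N) ℂ) {g : Fin N → ℝ → ℂ} {M : ℝ}
    (hg : ∀ n, Measurable (g n)) (hM : ∀ n x, ‖g n x‖ ≤ M) (i : Fin N) (x : ℝ) :
    kconv s (fun y => (Q *ᵥ fun m => g m y) i) x = (Q *ᵥ fun m => kconv s (g m) x) i := by
  unfold kconv Matrix.mulVec dotProduct
  simp only [Finset.mul_sum, mul_left_comm _ (Q i _)]
  rw [integral_finsetSum _ fun m _ =>
    (integrable_kernel_mul hs (hg m) (hM m) (ofReal_mem_strip hs x)).const_mul _]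
  simp only [integral_const_mul]

/-- For bounded functions and any admissible matrix `C`, the TBA equation is equivalent to the one
with `C = 0`. -/
theorem eq_conv_Phi_iff (hs : 0 < s) {C : Matrix (Fin N) (Fin N) ℝ} (hC : MatLtTwo C)
    {f g : Fin N → ℝ → ℂ} (hf : ∀ n, Measurable (f n)) (hg : ∀ n, Measurable (g n)) {M M' : ℝ}
    (hM : ∀ n x, ‖f n x‖ ≤ M) (hM' : ∀ n x, ‖g n x‖ ≤ M') :
    (∀ (x : ℝ) n, f n x =
      conv (Phi s C) (fun y m => g m y - (C.map Complex.ofReal *ᵥ fun l => f l y) m) x n) ↔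
      ∀ (x : ℝ) n, f n x = kconv s (g n) x := by
  obtain ⟨Pr, Qr, d, hPQr, hd, hC⟩ := hC.exists_diagonalisation
  set P := Pr.map Complex.ofReal with hP
  set Q := Qr.map Complex.ofReal with hQ
  have hPQ : P * Q = 1 := by
    have := congrArg (fun A : Matrix (Fin N) (Fin N) ℝ => A.map Complex.ofRealHom) hPQr
    simpa [Matrix.map_mul] using! this
  have hQP : Q * P = 1 := mul_eq_one_comm.1 hPQ
  have hQC : Q * C.map Complex.ofReal = Matrix.diagonal (fun i => (d i : ℂ)) * Q := by
    have h1 : Qr * C = Matrix.diagonal d * Qr := by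
      rw [hC, ← Matrix.mul_assoc, ← Matrix.mul_assoc, mul_eq_one_comm.1 hPQr, Matrix.one_mul]
    have := congrArg (fun A : Matrix (Fin N) (Fin N) ℝ => A.map Complex.ofRealHom) h1
    simp only [Matrix.map_mul, Matrix.diagonal_map (map_zero Complex.ofRealHom)] at this
    exact this
  have hinv : ∀ a b : Fin N → ℂ, (∀ n, a n = (P *ᵥ b) n) ↔ ∀ i, (Q *ᵥ a) i = b i := by
    intro a b
    rw [← funext_iff, ← funext_iff]
    constructor
    · rintro rfl; rw [Matrix.mulVec_mulVec, hQP, Matrix.one_mulVec]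
    · rintro rfl; rw [Matrix.mulVec_mulVec, hPQ, Matrix.one_mulVec]
  set f' : Fin N → ℝ → ℂ := fun i y => (Q *ᵥ fun m => f m y) i with hf'
  set g' : Fin N → ℝ → ℂ := fun i y => (Q *ᵥ fun m => g m y) i with hg'
  have hmeas : ∀ {u : Fin N → ℝ → ℂ}, (∀ n, Measurable (u n)) →
      ∀ i, Measurable fun y => (Q *ᵥ fun m => u m y) i := by
    intro u hu i
    change Measurable fun y => ∑ m, Q i m * u m y
    exact Finset.measurable_sum _ fun m _ => (hu m).const_mul _
  have hf'm := hmeas hf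
  have hg'm := hmeas hg
  have hf'B : ∀ i y, ‖f' i y‖ ≤ ∑ m, ‖Q i m‖ * M := fun i y => norm_mulVec_le Q (fun m => hM m y) i
  have hg'B : ∀ i y, ‖g' i y‖ ≤ ∑ m, ‖Q i m‖ * M' := fun i y =>
      norm_mulVec_le Q (fun m => hM' m y) i
  have hconv : ∀ (x : ℝ) n,
      conv (Phi s C) (fun y m => g m y - (C.map Complex.ofReal *ᵥ fun l => f l y) m) x n =
      (P *ᵥ fun i => ∫ y, phi s (d i) (x - y) * (g' i y - d i * f' i y)) n := by
    intro x n
    have e : ∀ y, (Phi s C (x - y) *ᵥ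
        fun m => g m y - (C.map Complex.ofReal *ᵥ fun l => f l y) m) n =
        ∑ i, P n i * (phi s (d i) (x - y) * (g' i y - d i * f' i y)) := by
      intro y
      have hA : Phi s C (x - y) = P * Matrix.diagonal (fun i => phi s (d i) (x - y)) * Q := by
        ext n m
        rw [Phi_eq hs hPQr hC hd, mul_diagonal_mul_apply]
        rfl
      have hv : Q *ᵥ (fun m => g m y - (C.map Complex.ofReal *ᵥ fun l => f l y) m) =
          fun i => g' i y - d i * f' i y := by
        change Q *ᵥ ((fun m => g m y) - C.map Complex.ofReal *ᵥ fun l => f l y) = _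
        rw [Matrix.mulVec_sub, Matrix.mulVec_mulVec, hQC, ← Matrix.mulVec_mulVec]
        funext i
        simp only [Pi.sub_apply, Matrix.mulVec_diagonal, hg', hf']
      rw [hA, ← Matrix.mulVec_mulVec, ← Matrix.mulVec_mulVec, hv]
      simp only [Matrix.mulVec, dotProduct, Matrix.diagonal_apply, ite_mul, zero_mul,
        Finset.sum_ite_eq, Finset.mem_univ, if_true]
    unfold conv
    simp only [e]
    rw [integral_finsetSum]
    · simp only [integral_const_mul]
      rfl
    · intro i _
      refine Integrable.const_mul ?_ _
      refine ((integrable_phi hs (hd i)).comp_sub_left x).mul_bdd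
        (c := (∑ m, ‖Q i m‖ * M') + |d i| * (∑ m, ‖Q i m‖ * M)) ?_ (ae_of_all _ fun y => ?_)
      · exact ((hg'm i).sub ((hf'm i).const_mul _)).aestronglyMeasurable
      · refine (norm_sub_le _ _).trans (add_le_add (hg'B i y) ?_)
        rw [norm_mul, Complex.norm_real, Real.norm_eq_abs]
        gcongr
        exact hf'B i y
  simp only [hconv, hinv]
  have h1 : (∀ (x : ℝ) i, f' i x = ∫ y, phi s (d i) (x - y) * (g' i y - d i * f' i y)) ↔
      ∀ (x : ℝ) i, f' i x = kconv s (g' i) x := by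
    rw [forall_comm, forall_comm (α := ℝ)]
    exact forall_congr' fun i => eq_phi_conv_iff hs (hd i) (hf'm i) (hg'm i) (hf'B i) (hg'B i)
  rw [h1]
  refine forall_congr' fun x => ?_
  have h2 : ∀ i, kconv s (g' i) x = (Q *ᵥ fun m => kconv s (g m) x) i := fun i =>
    kconv_mulVec hs Q hg hM' i x
  simp only [h2, hf']
  rw [← hinv]
  simp only [Matrix.mulVec_mulVec, hPQ, Matrix.one_mulVec]

/-! ### Existence and uniqueness for the TBA equation -/

/-- The vector `w = (1 - G/2)⁻¹ 1` satisfies `G w < 2 w` entrywise and takes the place of a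
Perron–Frobenius eigenvector. It is bounded below by `1`, being the sum of the Neumann series
`∑ (G/2)^k 1`, whose terms are non-negative. -/
theorem exists_weight {G : Matrix (Fin N) (Fin N) ℝ} (hG : MatLtTwo G) (hG0 : NonNegative G) :
    ∃ w : Fin N → ℝ, (∀ n, 1 ≤ w n) ∧ ∀ n, (G *ᵥ w) n = 2 * w n - 2 := by
  obtain ⟨P, Q, d, hPQ, hd, hC⟩ := hG.exists_diagonalisation
  have hQP : Q * P = 1 := mul_eq_one_comm.1 hPQ
  set A : Matrix (Fin N) (Fin N) ℝ := (1 / 2 : ℝ) • G with hA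
  set e : Fin N → ℝ := fun i => d i / 2 with he
  have hAe : A = P * Matrix.diagonal e * Q := by
    have h : Matrix.diagonal e = (1 / 2 : ℝ) • Matrix.diagonal d := by
      rw [← Matrix.diagonal_smul]; congr 1; funext i; simp [he]; ring
    rw [hA, h, mul_smul_comm, smul_mul_assoc, ← hC]
  have hpow : ∀ K : ℕ, A ^ K = P * Matrix.diagonal (fun i => e i ^ K) * Q := by
    intro K
    induction K with
    | zero => simp [hPQ]
    | succ K ih =>
      rw [pow_succ, ih, hAe]
      calc _ = P * Matrix.diagonal (fun i => e i ^ K) * (Q * P) * Matrix.diagonal e * Q := by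
            simp only [Matrix.mul_assoc]
        _ = P * (Matrix.diagonal (fun i => e i ^ K) * Matrix.diagonal e) * Q := by
            rw [hQP, mul_one]; simp only [Matrix.mul_assoc]
        _ = _ := by rw [Matrix.diagonal_mul_diagonal]; simp only [pow_succ]
  set w : Fin N → ℝ := (P * Matrix.diagonal (fun i => (1 - e i)⁻¹) * Q) *ᵥ 1 with hw
  have he1 : ∀ i, |e i| < 1 := fun i => by
    rw [he]; simp only [abs_div, Nat.abs_ofNat]; linarith [hd i]
  have hAw : A *ᵥ w = w - 1 := by
    have h1 : A * (P * Matrix.diagonal (fun i => (1 - e i)⁻¹) * Q) =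
        P * Matrix.diagonal (fun i => (1 - e i)⁻¹) * Q - 1 := by
      rw [hAe]
      calc _ = P * Matrix.diagonal e * (Q * P) * Matrix.diagonal (fun i => (1 - e i)⁻¹) * Q := by
            simp only [Matrix.mul_assoc]
        _ = P * (Matrix.diagonal e * Matrix.diagonal (fun i => (1 - e i)⁻¹)) * Q := by
            rw [hQP, mul_one]; simp only [Matrix.mul_assoc]
        _ = P * (Matrix.diagonal (fun i => (1 - e i)⁻¹) - 1) * Q := by
            rw [Matrix.diagonal_mul_diagonal, ← Matrix.diagonal_one, Matrix.diagonal_sub]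
            congr 3
            funext i
            have : 1 - e i ≠ 0 := by linarith [(abs_lt.1 (he1 i)).2]
            field_simp
            ring
        _ = _ := by rw [Matrix.mul_sub, Matrix.sub_mul, mul_one, hPQ]
    rw [hw, Matrix.mulVec_mulVec, h1, Matrix.sub_mulVec, Matrix.one_mulVec]
  have hA0 : ∀ v : Fin N → ℝ, 0 ≤ v → 0 ≤ A *ᵥ v := fun v hv n =>
    show 0 ≤ ∑ m, A n m * v m from
      Finset.sum_nonneg fun m _ => mul_nonneg (by simp [hA, hG0 n m]) (hv m)
  have hAK0 : ∀ K : ℕ, (0 : Fin N → ℝ) ≤ A ^ K *ᵥ 1 := by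
    intro K
    induction K with
    | zero => simp
    | succ K ih => rw [pow_succ', ← Matrix.mulVec_mulVec]; exact hA0 _ ih
  -- `A ^ K w` is the tail of the Neumann series: it decreases to zero, hence is non-negative
  have hanti : ∀ n, Antitone fun K : ℕ => (A ^ K *ᵥ w) n := fun n => by
    refine antitone_nat_of_succ_le fun K => ?_
    rw [pow_succ, ← Matrix.mulVec_mulVec, hAw, Matrix.mulVec_sub, Pi.sub_apply]
    have := hAK0 K n
    simp only [Pi.zero_apply] at this
    linarith
  have hlim : ∀ n, Tendsto (fun K : ℕ => (A ^ K *ᵥ w) n) atTop (𝓝 0) := fun n => by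
    have h : ∀ K : ℕ, (A ^ K *ᵥ w) n = ∑ m, (∑ i, P n i * e i ^ K * Q i m) * w m := fun K => by
      rw [hpow, Matrix.mulVec, dotProduct]
      simp only [mul_diagonal_mul_apply]
    simp only [h]
    have h0 : ∀ i, Tendsto (fun K : ℕ => e i ^ K) atTop (𝓝 0) := fun i =>
      tendsto_pow_atTop_nhds_zero_of_abs_lt_one (he1 i)
    have := tendsto_finsetSum (Finset.univ (α := Fin N)) fun m _ =>
      (tendsto_finsetSum (Finset.univ (α := Fin N)) fun i _ =>
        ((h0 i).const_mul (P n i)).mul_const (Q i m)).mul_const (w m)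
    simpa using! this
  refine ⟨w, fun n => ?_, fun n => ?_⟩
  · have h1 := (hanti n).le_of_tendsto (hlim n) 1
    rw [pow_one, hAw] at h1
    simp only [Pi.sub_apply, Pi.one_apply] at h1
    linarith
  · have h1 := congrFun hAw n
    rw [hA, Matrix.smul_mulVec] at h1
    simp only [Pi.sub_apply, Pi.one_apply, Pi.smul_apply, smul_eq_mul] at h1
    linarith

/-- The kernel is positive on the real line. -/
theorem norm_kernel_ofReal (hs : 0 < s) (x : ℝ) :
    ((‖kernel s x‖ : ℝ) : ℂ) = kernel s x := by
  rw [kernel_ofReal, Complex.norm_real, Real.norm_of_nonneg]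
  have := Real.cosh_pos (Real.pi / (2 * s) * x)
  positivity

theorem norm_kconv_le (hs : 0 < s) {g : ℝ → ℂ} {B : ℝ} (hB : ∀ x, ‖g x‖ ≤ B) (x : ℝ) :
    ‖kconv s g x‖ ≤ B / 2 := by
  have hi := integrable_kernel_line hs (ofReal_mem_strip hs x)
  have h : ∫ y : ℝ, ‖kernel s (x - y)‖ = 1 / 2 := by
    have := integral_kernel_sub hs (ofReal_mem_strip hs x)
    have e : ∀ y : ℝ, kernel s (x - y) = ((‖kernel s (x - y)‖ : ℝ) : ℂ) := fun y => by
      rw [← Complex.ofReal_sub, norm_kernel_ofReal hs]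
    rw [integral_congr_ae (ae_of_all _ e), integral_complex_ofReal] at this
    apply Complex.ofReal_injective
    rw [this]; norm_num
  refine (norm_integral_le_of_norm_le (hi.norm.mul_const B) (ae_of_all _ fun y => ?_)).trans ?_
  · rw [norm_mul]
    gcongr
    exact hB y
  · rw [integral_mul_const, h]; linarith

/-- Convolutions of the kernel with real functions are real on the real line. -/
theorem kconv_ofReal (hs : 0 < s) (u : ℝ → ℝ) (x : ℝ) :
    kconv s (fun y => (u y : ℂ)) x = ((kconv s (fun y => (u y : ℂ)) x).re : ℂ) := by
  have e : ∀ y : ℝ, kernel s (x - y) * (u y : ℂ) =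
      ((‖kernel s (x - y)‖ * u y : ℝ) : ℂ) := fun y => by
    rw [Complex.ofReal_mul, ← Complex.ofReal_sub, norm_kernel_ofReal hs]
  unfold kconv
  simp only [e]
  rw [integral_complex_ofReal, Complex.ofReal_re]

theorem kconv_sub (hs : 0 < s) {g h : ℝ → ℂ} (hg : Measurable g) (hh : Measurable h) {B B' : ℝ}
    (hB : ∀ x, ‖g x‖ ≤ B) (hB' : ∀ x, ‖h x‖ ≤ B') (x : ℝ) :
    kconv s (fun y => g y - h y) x = kconv s g x - kconv s h x := by
  have hx := ofReal_mem_strip hs x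
  unfold kconv
  rw [← integral_sub (integrable_kernel_mul hs hg hB hx) (integrable_kernel_mul hs hh hB' hx)]
  simp only [mul_sub]

theorem continuous_kconv (hs : 0 < s) {g : ℝ → ℂ} (hg : Measurable g) {B : ℝ}
    (hB : ∀ x, ‖g x‖ ≤ B) : Continuous fun x : ℝ => kconv s g x := by
  rw [continuous_iff_continuousAt]
  intro x
  exact ContinuousAt.comp (g := kconv s g) (f := fun x : ℝ => (x : ℂ))
    (hasDerivAt_kconv hs hg hB (ofReal_mem_strip hs x)).continuousAt
    Complex.continuous_ofReal.continuousAt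

theorem abs_log_exp_add_exp_sub_le (α p q : ℝ) :
    |Real.log (Real.exp α + Real.exp p) - Real.log (Real.exp α + Real.exp q)| ≤ |p - q| := by
  have key : ∀ p q : ℝ, Real.log (Real.exp α + Real.exp p) ≤
      |p - q| + Real.log (Real.exp α + Real.exp q) := by
    intro p q
    have h : Real.exp α + Real.exp p ≤ Real.exp |p - q| * (Real.exp α + Real.exp q) := by
      rw [mul_add]
      apply add_le_add
      · exact le_mul_of_one_le_left (Real.exp_pos _).le (Real.one_le_exp (abs_nonneg _))
      · rw [← Real.exp_add]; apply Real.exp_le_exp.2; linarith [le_abs_self (p - q)]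
    refine (Real.log_le_log (by positivity) h).trans (le_of_eq ?_)
    rw [Real.log_mul (Real.exp_pos _).ne' (by positivity), Real.log_exp]
  rw [abs_le]
  have h1 := key p q
  have h2 := key q p
  rw [abs_sub_comm q p] at h2
  constructor <;> linarith

theorem abs_log_exp_add_exp_le {α p E M : ℝ} (hE : Real.exp α ≤ E) (hM : |p| ≤ M) :
    |Real.log (Real.exp α + Real.exp p)| ≤ E + Real.exp M + M := by
  have h := abs_le.1 hM
  have h1 : p ≤ Real.log (Real.exp α + Real.exp p) := by
    rw [Real.le_log_iff_exp_le (by positivity)]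
    linarith [Real.exp_pos α]
  have h2 := Real.log_le_self (x := Real.exp α + Real.exp p) (by positivity)
  have h3 := Real.exp_le_exp.2 h.2
  have h4 := Real.exp_pos M
  have h5 := Real.exp_pos α
  rw [abs_le]
  constructor <;> linarith

/-- The vector `G · log (e^{-a} + e^f)`. -/
noncomputable def logSource (G : Matrix (Fin N) (Fin N) ℝ) (a f : Fin N → ℝ → ℝ) (n : Fin N)
    (y : ℝ) : ℝ :=
  (G *ᵥ fun m => Real.log (Real.exp (-a m y) + Real.exp (f m y))) n

theorem continuous_logSource (G : Matrix (Fin N) (Fin N) ℝ) {a f : Fin N → ℝ → ℝ}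
    (ha : ∀ n, Continuous (a n)) (hf : ∀ n, Continuous (f n)) (n : Fin N) :
    Continuous (logSource G a f n) := by
  change Continuous fun y => ∑ m, G n m * Real.log (Real.exp (-a m y) + Real.exp (f m y))
  refine continuous_finsetSum _ fun m _ => continuous_const.mul ?_
  refine Continuous.log ?_ fun y => by positivity
  exact (Real.continuous_exp.comp (ha m).neg).add (Real.continuous_exp.comp (hf m))

theorem continuous_ofReal_logSource (G : Matrix (Fin N) (Fin N) ℝ) {a f : Fin N → ℝ → ℝ}
    (ha : ∀ n, Continuous (a n)) (hf : ∀ n, Continuous (f n)) (n : Fin N) :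
    Continuous fun y => (logSource G a f n y : ℂ) :=
  Complex.continuous_ofReal.comp (continuous_logSource G ha hf n)

theorem exists_logSource_bound (G : Matrix (Fin N) (Fin N) ℝ) {a f : Fin N → ℝ → ℝ} {E M : ℝ}
    (hE : ∀ n x, Real.exp (-a n x) ≤ E) (hM : ∀ n x, |f n x| ≤ M) :
    ∃ B : ℝ, ∀ n y, ‖((logSource G a f n y : ℝ) : ℂ)‖ ≤ B := by
  refine ⟨∑ n, ∑ m, |G n m| * (E + Real.exp M + M), fun n y => ?_⟩
  rw [Complex.norm_real, Real.norm_eq_abs]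
  have h : |logSource G a f n y| ≤ ∑ m, |G n m| * (E + Real.exp M + M) := by
    change |∑ m, G n m * Real.log (Real.exp (-a m y) + Real.exp (f m y))| ≤ _
    refine (Finset.abs_sum_le_sum_abs _ _).trans
      (Finset.sum_le_sum fun m _ => ?_)
    rw [abs_mul]
    gcongr
    exact abs_log_exp_add_exp_le (hE m y) (hM m y)
  refine h.trans (Finset.single_le_sum (f := fun n => ∑ m, |G n m| * (E + Real.exp M + M))
    (fun i _ => Finset.sum_nonneg fun m _ => ?_) (Finset.mem_univ n))
  have h1 := (Real.exp_pos (-a m y)).le.trans (hE m y)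
  have h2 := (abs_nonneg _).trans (hM m y)
  positivity

theorem exists_norm_bound (f : Fin N → (ℝ →ᵇ ℝ)) : ∃ M : ℝ, ∀ n x, |f n x| ≤ M :=
  ⟨‖f‖, fun n x => ((f n).norm_coe_le_norm x).trans (norm_le_pi_norm f n)⟩

/-- Existence and uniqueness for the TBA equation with `C = 0`, by the contraction principle in a
supremum norm weighted by the vector of `exists_weight`. -/
theorem exists_unique_fixedPoint (hs : 0 < s) {G : Matrix (Fin N) (Fin N) ℝ} (hG : MatLtTwo G)
    (hG0 : NonNegative G) {a : Fin N → ℝ → ℝ} (ha : ∀ n, Continuous (a n)) {E : ℝ}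
    (hE : ∀ n x, Real.exp (-a n x) ≤ E) :
    ∃ fstar : Fin N → (ℝ →ᵇ ℝ), ∀ f : Fin N → (ℝ →ᵇ ℝ),
      (∀ (x : ℝ) n, (f n x : ℂ) = kconv s (fun y => (logSource G a (fun n => f n) n y : ℂ)) x) ↔
        f = fstar := by
  obtain ⟨w, hw1, hGw⟩ := exists_weight hG hG0
  have hw0 : ∀ n, 0 < w n := fun n => one_pos.trans_le (hw1 n)
  have hbd : ∀ f : Fin N → (ℝ →ᵇ ℝ), ∃ B : ℝ, ∀ n y,
      ‖((logSource G a (fun n => f n) n y : ℝ) : ℂ)‖ ≤ B := fun f =>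
    (exists_norm_bound f).elim fun M hM => exists_logSource_bound G hE hM
  have hcont : ∀ (f : Fin N → (ℝ →ᵇ ℝ)) n,
      Continuous fun y => ((logSource G a (fun n => f n) n y : ℝ) : ℂ) := fun f n =>
    continuous_ofReal_logSource G ha (fun n => (f n).continuous) n
  have hT : ∀ f : Fin N → (ℝ →ᵇ ℝ), ∃ g : Fin N → (ℝ →ᵇ ℝ), ∀ n (x : ℝ),
      (g n x : ℂ) = kconv s (fun y => (logSource G a (fun n => f n) n y : ℂ)) x := by
    intro f
    obtain ⟨B, hB⟩ := hbd f
    refine ⟨fun n => BoundedContinuousFunction.ofNormedAddCommGroup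
      (fun x : ℝ => (kconv s (fun y => (logSource G a (fun n => f n) n y : ℂ)) x).re)
      (Complex.continuous_re.comp (continuous_kconv hs (hcont f n).measurable (hB n))) (B / 2)
      fun x => (Complex.abs_re_le_norm _).trans (norm_kconv_le hs (hB n) x), fun n x => ?_⟩
    exact (kconv_ofReal hs _ x).symm
  choose T hT using hT
  have hTeq : ∀ f, (∀ (x : ℝ) n,
      (f n x : ℂ) = kconv s (fun y => (logSource G a (fun n => f n) n y : ℂ)) x) ↔ T f = f := by
    intro f
    constructor
    · intro h
      funext n
      ext x
      have := (hT f n x).trans (h x n).symm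
      exact_mod_cast this
    · intro h x n
      rw [← hT f n x, h]
  -- the same operator in the rescaled unknowns `f n / w n`
  set S : (Fin N → (ℝ →ᵇ ℝ)) → Fin N → (ℝ →ᵇ ℝ) := fun u n => (w n)⁻¹ • T (fun m => w m • u m) n
    with hS
  have hW : ∃ W : ℝ, 1 ≤ W ∧ ∀ n, w n ≤ W := by
    refine ⟨1 + ∑ n, w n, ?_, fun n => ?_⟩
    · linarith [Finset.sum_nonneg fun n (_ : n ∈ Finset.univ) => (hw0 n).le]
    · linarith [Finset.single_le_sum (f := w) (fun n _ => (hw0 n).le) (Finset.mem_univ n)]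
  obtain ⟨W, hW1, hW⟩ := hW
  have hW0 : 0 < W := one_pos.trans_le hW1
  have hWi : W⁻¹ ≤ 1 := inv_le_one_of_one_le₀ hW1
  have hcontr : ContractingWith (Real.toNNReal (1 - W⁻¹)) S := by
    refine ⟨?_, LipschitzWith.of_dist_le_mul fun u v => ?_⟩
    · rw [Real.toNNReal_lt_one]
      linarith [inv_pos.2 hW0]
    · rw [Real.coe_toNNReal _ (by linarith)]
      have hnn : 0 ≤ (1 - W⁻¹) * dist u v := mul_nonneg (by linarith) dist_nonneg
      rw [dist_pi_le_iff hnn]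
      intro n
      rw [BoundedContinuousFunction.dist_le hnn]
      intro x
      set f : Fin N → (ℝ →ᵇ ℝ) := fun m => w m • u m with hf
      set g : Fin N → (ℝ →ᵇ ℝ) := fun m => w m • v m with hg
      have hpt : ∀ y, ‖((logSource G a (fun n => f n) n y : ℝ) : ℂ) -
          ((logSource G a (fun n => g n) n y : ℝ) : ℂ)‖ ≤ (2 * w n - 2) * dist u v := by
        intro y
        rw [← Complex.ofReal_sub, Complex.norm_real, Real.norm_eq_abs, logSource, logSource,
          ← Pi.sub_apply, ← Matrix.mulVec_sub, ← hGw]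
        simp only [Matrix.mulVec, dotProduct]
        refine (Finset.abs_sum_le_sum_abs _ _).trans ?_
        rw [Finset.sum_mul]
        refine Finset.sum_le_sum fun m _ => ?_
        rw [abs_mul, abs_of_nonneg (hG0 n m), mul_assoc]
        refine mul_le_mul_of_nonneg_left ?_ (hG0 n m)
        refine (abs_log_exp_add_exp_sub_le _ _ _).trans ?_
        simp only [hf, hg, BoundedContinuousFunction.coe_smul, smul_eq_mul]
        rw [← mul_sub, abs_mul, abs_of_pos (hw0 m)]
        refine mul_le_mul_of_nonneg_left ?_ (hw0 m).le
        rw [← Real.dist_eq]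
        exact ((u m).dist_coe_le_dist y).trans (dist_le_pi_dist u v m)
      obtain ⟨B, hB⟩ := hbd f
      obtain ⟨B', hB'⟩ := hbd g
      have hk := norm_kconv_le hs hpt x
      rw [kconv_sub hs (hcont f n).measurable (hcont g n).measurable (hB n) (hB' n), ← hT, ← hT,
        ← Complex.ofReal_sub, Complex.norm_real, Real.norm_eq_abs] at hk
      have hS' : dist (S u n x) (S v n x) = (w n)⁻¹ * |T f n x - T g n x| := by
        rw [Real.dist_eq, hS]
        simp only [BoundedContinuousFunction.coe_smul, smul_eq_mul]
        rw [← mul_sub, abs_mul, abs_of_pos (inv_pos.2 (hw0 n))]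
      rw [hS']
      calc _ ≤ (w n)⁻¹ * ((2 * w n - 2) * dist u v / 2) :=
            mul_le_mul_of_nonneg_left hk (inv_pos.2 (hw0 n)).le
        _ = (1 - (w n)⁻¹) * dist u v := by
            have := (hw0 n).ne'
            field_simp
        _ ≤ _ := by
            have := inv_anti₀ (hw0 n) (hW n)
            gcongr
  have hscale : ∀ f : Fin N → (ℝ →ᵇ ℝ), (fun m => w m • (w m)⁻¹ • f m) = f := fun f => by
    funext m; rw [smul_inv_smul₀ (hw0 m).ne']
  refine ⟨fun n => w n • hcontr.fixedPoint S n, fun f => (hTeq f).trans ⟨fun h => ?_, fun h => ?_⟩⟩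
  · have hfix : Function.IsFixedPt S (fun n => (w n)⁻¹ • f n) := by
      rw [Function.IsFixedPt, hS]
      beta_reduce
      rw [hscale, h]
    have h1 := hcontr.fixedPoint_unique hfix
    rw [← h1]
    exact (hscale f).symm
  · have hfix := hcontr.fixedPoint_isFixedPt
    rw [Function.IsFixedPt] at hfix
    rw [h]
    funext n
    have h1 := congrFun hfix n
    simp only [hS] at h1
    rw [inv_smul_eq_iff₀ (hw0 n).ne'] at h1
    exact h1

/-! ### Analytic extension and the Y-system -/

theorem MemA.cexp {f : ℂ → ℂ} (hf : MemA s f) : MemA s fun z => Complex.exp (f z) :=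
  ⟨hf.1.cexp, hf.2.cexp⟩

theorem MemBA.sum_mul {F : Fin N → ℂ → ℂ} (hF : ∀ n, MemBA s (F n)) (c : Fin N → ℂ) :
    MemBA s fun z => ∑ m, c m * F m z := by
  choose hA B hB using hF
  refine ⟨⟨?_, ?_⟩, ∑ m, ‖c m‖ * B m, fun z hz => ?_⟩
  · exact DifferentiableOn.fun_sum fun m _ => (hA m).1.const_mul _
  · exact continuousOn_finsetSum _ fun m _ => continuousOn_const.mul (hA m).2
  · refine (norm_sum_le _ _).trans (Finset.sum_le_sum fun m _ => ?_)
    rw [norm_mul]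
    gcongr
    exact hB m z hz

theorem exists_lipschitz_kconv (hs : 0 < s) {g : ℝ → ℂ} (hg : Measurable g) {B : ℝ}
    (hB : ∀ x, ‖g x‖ ≤ B) : ∃ Λ : ℝ, ∀ x y : ℝ, ‖kconv s g x - kconv s g y‖ ≤ Λ * |x - y| := by
  have hp := Real.pi_pos
  have hi := integrable_inv_cosh (c := Real.pi / (2 * s)) (by positivity)
  refine ⟨∫ y : ℝ, Real.pi / (8 * s ^ 2) * (Real.cosh (Real.pi / (2 * s) * y))⁻¹ * B, fun x y => ?_⟩
  have hd : ∀ x : ℝ, HasDerivAt (fun x : ℝ => kconv s g x)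
      (∫ y : ℝ, kernelDeriv s (x - y) * g y) x := fun x =>
    (hasDerivAt_kconv hs hg hB (ofReal_mem_strip hs x)).comp_ofReal
  rw [← Real.norm_eq_abs]
  refine convex_univ.norm_image_sub_le_of_norm_hasDerivWithin_le (f := fun x : ℝ => kconv s g x)
    (fun x _ => (hd x).hasDerivWithinAt) (fun x _ => ?_) (mem_univ y) (mem_univ x)
  rw [← integral_sub_left_eq_self (fun y : ℝ => Real.pi / (8 * s ^ 2) *
    (Real.cosh (Real.pi / (2 * s) * y))⁻¹ * B) volume x]
  refine norm_integral_le_of_norm_le (((hi.comp_sub_left x).const_mul _).mul_const _)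
    (ae_of_all _ fun y => ?_)
  have h := norm_kernelDeriv_le hs (ofReal_mem_strip hs (x - y))
  rw [Complex.ofReal_im, mul_zero, Real.cos_zero, one_pow, mul_one, Complex.ofReal_re,
    Complex.ofReal_sub] at h
  rw [norm_mul]
  exact mul_le_mul h (hB y) (norm_nonneg _) ((norm_nonneg _).trans h)

theorem abs_log_sub_log_le {c p q : ℝ} (hc : 0 < c) (hp : c ≤ p) (hq : c ≤ q) :
    |Real.log p - Real.log q| ≤ c⁻¹ * |p - q| := by
  have key : ∀ p q : ℝ, c ≤ p → c ≤ q → Real.log p - Real.log q ≤ c⁻¹ * |p - q| := by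
    intro p q hp hq
    have hp0 := hc.trans_le hp
    have hq0 := hc.trans_le hq
    rw [← Real.log_div hp0.ne' hq0.ne']
    calc _ ≤ p / q - 1 := Real.log_le_sub_one_of_pos (by positivity)
      _ = q⁻¹ * (p - q) := by field_simp
      _ ≤ q⁻¹ * |p - q| := by gcongr; exact le_abs_self _
      _ ≤ _ := by gcongr
  have h1 := key p q hp hq
  have h2 := key q p hq hp
  rw [abs_sub_comm q p] at h2
  rw [abs_le]
  constructor <;> linarith

theorem abs_exp_sub_exp_le {M u v : ℝ} (hu : u ≤ M) (hv : v ≤ M) :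
    |Real.exp u - Real.exp v| ≤ Real.exp M * |u - v| := by
  have key : ∀ u v : ℝ, u ≤ M → Real.exp u - Real.exp v ≤ Real.exp M * |u - v| := by
    intro u v hu
    have h1 := Real.add_one_le_exp (v - u)
    have h2 : Real.exp v = Real.exp u * Real.exp (v - u) := by rw [← Real.exp_add]; ring_nf
    calc _ = Real.exp u * (1 - Real.exp (v - u)) := by rw [h2]; ring
      _ ≤ Real.exp u * |u - v| := by
          gcongr
          linarith [le_abs_self (u - v)]
      _ ≤ _ := by gcongr
  have h1 := key u v hu
  have h2 := key v u hv
  rw [abs_sub_comm v u] at h2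
  rw [abs_le]
  constructor <;> linarith

/-- The logarithm in the source term inherits Hölder continuity from `e^{-a}`, as `f` is bounded and
Lipschitz. -/
theorem exists_holder_log {a f : ℝ → ℝ} (ha : IsHolder fun x => Real.exp (-a x)) {M Λ : ℝ}
    (hM : ∀ x, |f x| ≤ M) (hΛ : ∀ x y, |f x - f y| ≤ Λ * |x - y|) :
    ∃ K α : ℝ, 0 < α ∧ ∀ x y, |Real.log (Real.exp (-a x) + Real.exp (f x)) -
      Real.log (Real.exp (-a y) + Real.exp (f y))| ≤ K * |x - y| ^ α := by
  obtain ⟨K, α, hα0, hα1, hH⟩ := ha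
  have hα0' : (0 : ℝ) < α := by exact_mod_cast hα0
  have hα1' : (α : ℝ) ≤ 1 := by exact_mod_cast hα1
  have hM0 : 0 ≤ M := (abs_nonneg _).trans (hM 0)
  have hΛ0 : 0 ≤ Λ := by
    have := (abs_nonneg _).trans (hΛ 1 0)
    simpa using this
  refine ⟨(Real.exp (-M))⁻¹ * (K + Real.exp M * (Λ + (M + M))), α, hα0', fun x y => ?_⟩
  have hlow : ∀ x, Real.exp (-M) ≤ Real.exp (-a x) + Real.exp (f x) := fun x => by
    have := Real.exp_le_exp.2 (neg_le_of_abs_le (hM x))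
    linarith [Real.exp_pos (-a x)]
  have hu : ∀ x, f x ≤ M := fun x => (le_abs_self _).trans (hM x)
  have h1 := abs_log_sub_log_le (Real.exp_pos _) (hlow x) (hlow y)
  have h2 := abs_exp_sub_exp_le (hu x) (hu y)
  have h3 := hH.dist_le x y
  rw [Real.dist_eq, Real.dist_eq] at h3
  have hpow : 0 ≤ |x - y| ^ (α : ℝ) := by positivity
  have h4 : |f x - f y| ≤ (Λ + (M + M)) * |x - y| ^ (α : ℝ) := by
    rw [add_mul]
    by_cases hxy : |x - y| ≤ 1
    · have : |x - y| ≤ |x - y| ^ (α : ℝ) := by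
        conv_lhs => rw [← Real.rpow_one |x - y|]
        rcases eq_or_lt_of_le (abs_nonneg (x - y)) with h0 | h0
        · rw [← h0, Real.zero_rpow one_ne_zero, Real.zero_rpow hα0'.ne']
        · exact Real.rpow_le_rpow_of_exponent_ge h0 hxy hα1'
      have h5 : Λ * |x - y| ≤ Λ * |x - y| ^ (α : ℝ) := by gcongr
      have h6 := hΛ x y
      have h7 : 0 ≤ (M + M) * |x - y| ^ (α : ℝ) := by positivity
      linarith
    · have h5 : 1 ≤ |x - y| ^ (α : ℝ) := Real.one_le_rpow (not_le.1 hxy).le hα0'.le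
      have h6 : |f x - f y| ≤ M + M := (abs_sub _ _).trans (add_le_add (hM x) (hM y))
      have h7 : 0 ≤ Λ * |x - y| ^ (α : ℝ) := by positivity
      nlinarith
  refine h1.trans ?_
  rw [mul_assoc]
  gcongr
  calc _ = |(Real.exp (-a x) - Real.exp (-a y)) + (Real.exp (f x) - Real.exp (f y))| := by ring_nf
    _ ≤ _ := abs_add_le _ _
    _ ≤ K * |x - y| ^ (α : ℝ) + Real.exp M * ((Λ + (M + M)) * |x - y| ^ (α : ℝ)) :=
        add_le_add h3 (h2.trans (by gcongr))
    _ = _ := by ring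

/-- For bounded continuous `f`, the TBA equation does not depend on `C`. -/
theorem isTBASolution_iff (hs : 0 < s) {G C : Matrix (Fin N) (Fin N) ℝ} (hC : MatLtTwo C)
    {a : Fin N → ℝ → ℝ} (ha : ∀ n, Continuous (a n)) {E : ℝ} (hE : ∀ n x, Real.exp (-a n x) ≤ E)
    (f : Fin N → (ℝ →ᵇ ℝ)) :
    IsTBASolution s G C a (fun n => f n) ↔ ∀ (x : ℝ) n,
      (f n x : ℂ) = kconv s (fun y => (logSource G a (fun n => f n) n y : ℂ)) x := by
  obtain ⟨M, hM⟩ := exists_norm_bound f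
  obtain ⟨B, hB⟩ := exists_logSource_bound G hE hM
  rw [← eq_conv_Phi_iff hs hC (f := fun n y => (f n y : ℂ))
    (fun n => (Complex.continuous_ofReal.comp (f n).continuous).measurable)
    (fun n => (continuous_ofReal_logSource G ha (fun n => (f n).continuous) n).measurable)
    (M := M) (fun n x => by rw [Complex.norm_real]; exact hM n x) hB]
  have e : (fun (y : ℝ) (m : Fin N) => (source G C a (fun n => f n) y m : ℂ)) =
      fun y m => (logSource G a (fun n => f n) m y : ℂ) -
        (C.map Complex.ofReal *ᵥ fun l => (f l y : ℂ)) m := by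
    funext y m
    rw [source, Pi.sub_apply, Complex.ofReal_sub, logSource]
    congr 1
    simp [Matrix.mulVec, dotProduct]
  unfold IsTBASolution
  rw [e]

/-- The solution of the TBA equation extends to the closed strip, and there satisfies the
logarithmic form of the Y-system. -/
theorem exists_extension_of_fixedPoint (hs : 0 < s) {G : Matrix (Fin N) (Fin N) ℝ}
    {a : Fin N → ℝ → ℝ} (ha : ∀ n, Continuous (a n)) {E : ℝ} (hE : ∀ n x, Real.exp (-a n x) ≤ E)
    (ha_holder : ∀ n, IsHolder (fun x => Real.exp (-a n x))) (f : Fin N → (ℝ →ᵇ ℝ))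
    (hf : ∀ (x : ℝ) n,
      (f n x : ℂ) = kconv s (fun y => (logSource G a (fun n => f n) n y : ℂ)) x) :
    ∃ F : Fin N → ℂ → ℂ, (∀ n, MemBA s (F n)) ∧ (∀ n (x : ℝ), F n x = f n x) ∧
      ∀ n (x : ℝ), F n (x + Complex.I * s) + F n (x - Complex.I * s) =
        (logSource G a (fun n => f n) n x : ℂ) := by
  obtain ⟨M, hM⟩ := exists_norm_bound f
  obtain ⟨B, hB⟩ := exists_logSource_bound G hE hM
  set L : Fin N → ℝ → ℝ := fun m y => Real.log (Real.exp (-a m y) + Real.exp (f m y)) with hL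
  have hLB : ∀ m y, ‖(L m y : ℂ)‖ ≤ E + Real.exp M + M := fun m y => by
    rw [Complex.norm_real]; exact abs_log_exp_add_exp_le (hE m y) (hM m y)
  have hLm : ∀ m, Measurable fun y => (L m y : ℂ) := fun m => by
    have h1 := (ha m).measurable
    have h2 := (f m).continuous.measurable
    fun_prop
  have hsum : ∀ n y, (logSource G a (fun n => f n) n y : ℂ) =
      (G.map Complex.ofReal *ᵥ fun m => (L m y : ℂ)) n := fun n y => by
    simp [logSource, Matrix.mulVec, dotProduct, hL]
  have hext : ∀ m, ∃ F : ℂ → ℂ, MemBA s F ∧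
      (∀ z ∈ strip s, F z = kconv s (fun y => (L m y : ℂ)) z) ∧
      ∀ x : ℝ, F (x + Complex.I * s) + F (x - Complex.I * s) = L m x := by
    intro m
    obtain ⟨Λ, hΛ⟩ := exists_lipschitz_kconv hs
      (continuous_ofReal_logSource G ha (fun n => (f n).continuous) m).measurable (hB m)
    have hΛ' : ∀ x y, |f m x - f m y| ≤ Λ * |x - y| := fun x y => by
      have := hΛ x y
      rwa [← hf x m, ← hf y m, ← Complex.ofReal_sub, Complex.norm_real, Real.norm_eq_abs] at this
    obtain ⟨K, α, hα, hK⟩ := exists_holder_log (ha_holder m) (hM m) hΛ'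
    refine exists_strip_extension hs (K := K) hα (hLB m) fun x y => ?_
    rw [← Complex.ofReal_sub, Complex.norm_real]
    exact hK x y
  choose F hF1 hF2 hF3 using hext
  refine ⟨fun n z => ∑ m, (G n m : ℂ) * F m z, fun n => MemBA.sum_mul hF1 _, fun n x => ?_,
    fun n x => ?_⟩
  · rw [hf x n]
    simp only [hsum]
    rw [kconv_mulVec hs _ hLm hLB]
    simp only [hF2 _ _ (ofReal_mem_strip hs x)]
    rfl
  · dsimp only
    rw [← Finset.sum_add_distrib, hsum]
    simp only [← mul_add, hF3]
    rfl

theorem one_add_exp_cpow (α φ γ : ℝ) :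
    (1 + Complex.exp (α + φ)) ^ (γ : ℂ) =
      Complex.exp (γ * α + γ * Real.log (Real.exp (-α) + Real.exp φ)) := by
  have h1 : 1 + Real.exp (α + φ) = Real.exp (α + Real.log (Real.exp (-α) + Real.exp φ)) := by
    rw [Real.exp_add, Real.exp_add, Real.exp_log (by positivity), mul_add, ← Real.exp_add α (-α),
      add_neg_cancel, Real.exp_zero]
  have h2 : (1 + Complex.exp (α + φ) : ℂ) = ((1 + Real.exp (α + φ) : ℝ) : ℂ) := by push_cast; rfl
  rw [h2, h1, ← Complex.ofReal_cpow (Real.exp_pos _).le, ← Real.exp_mul]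
  push_cast
  ring_nf

/-- The right-hand side of the Y-system, in exponential form. -/
theorem prod_one_add_exp_cpow (G : Matrix (Fin N) (Fin N) ℝ) (a f : Fin N → ℝ → ℝ) (n : Fin N)
    (x : ℝ) : ∏ m, (1 + Complex.exp (a m x + f m x)) ^ (G n m : ℂ) =
      Complex.exp (∑ m, (G n m : ℂ) * a m x + logSource G a f n x) := by
  simp only [one_add_exp_cpow]
  rw [← Complex.exp_sum, Finset.sum_add_distrib, logSource, Matrix.mulVec, dotProduct]
  push_cast
  rfl

/-- A continuous function whose exponential is `1` is constant. -/
theorem exists_int_of_exp_eq_one {φ : ℝ → ℂ} (hφ : Continuous φ) (h : ∀ x, Complex.exp (φ x) = 1) :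
    ∃ k : ℤ, ∀ x, φ x = k * (2 * Real.pi * Complex.I) := by
  choose k hk using fun x => Complex.exp_eq_one_iff.1 (h x)
  have hkc : Continuous k := by
    rw [Int.isClosedEmbedding_coe_real.isInducing.continuous_iff]
    have : ((↑) : ℤ → ℝ) ∘ k = fun x => (φ x).im / (2 * Real.pi) := by
      funext x
      have := Real.pi_pos
      rw [hk x]
      simp
    rw [this]
    exact (Complex.continuous_im.comp hφ).div_const _
  refine ⟨k 0, fun x => ?_⟩
  rw [hk x, PreconnectedSpace.constant inferInstance hkc (x := x) (y := 0)]

/-- A logarithmic solution of the Y-system, shifted by a valid asymptotics, gives a solution. -/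
theorem isYSolution_exp {G : Matrix (Fin N) (Fin N) ℝ} {a : Fin N → ℝ → ℝ} {f : Fin N → (ℝ →ᵇ ℝ)}
    {F A : Fin N → ℂ → ℂ} (hF : ∀ n, MemBA s (F n)) (hFr : ∀ n (x : ℝ), F n x = f n x)
    (hFb : ∀ n (x : ℝ), F n (x + Complex.I * s) + F n (x - Complex.I * s) =
        (logSource G a (fun n => f n) n x : ℂ)) (hA : ValidAsymptotics s G A)
    (hAr : ∀ n (x : ℝ), A n x = a n x) :
    IsYSolution s G A fun n z => Complex.exp (A n z + F n z) where
  memA n := MemA.cexp (DiffContOnCl.add (hA.memA n) (hF n).1)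
  ysystem n x := by
    simp only [hAr, hFr]
    rw [prod_one_add_exp_cpow G a (fun n => f n), ← hFb, ← Complex.exp_add]
    congr 1
    have := hA.linear n x
    simp only [hAr] at this
    linear_combination this
  positive n x := ⟨Real.exp (a n x + f n x), Real.exp_pos _, by rw [hAr, hFr]; push_cast; rfl⟩
  no_roots n z _ := Complex.exp_ne_zero _
  asymptotics n := by
    refine ⟨fun z => A n z + F n z, DiffContOnCl.add (hA.memA n) (hF n).1, fun z _ => rfl, ?_⟩
    simpa using hF n

/-- Uniqueness for the Y-system. With `D = log Y - A`, the function `Re D` on the real line solves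
the
TBA equation with `C = 0`; the branch of the logarithm contributes only constants in `2πi ℤ`, which
drop out on taking real parts. -/
theorem IsYSolution.eqOn_exp (hs : 0 < s) {G : Matrix (Fin N) (Fin N) ℝ} {a : Fin N → ℝ → ℝ}
    (ha : ∀ n, Continuous (a n)) {E : ℝ} (hE : ∀ n x, Real.exp (-a n x) ≤ E)
    {f : Fin N → (ℝ →ᵇ ℝ)}
    (hf : ∀ g : Fin N → (ℝ →ᵇ ℝ), (∀ (x : ℝ) n,
      (g n x : ℂ) = kconv s (fun y => (logSource G a (fun n => g n) n y : ℂ)) x) → g = f)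
    {F A Y : Fin N → ℂ → ℂ} (hF : ∀ n, MemBA s (F n)) (hFr : ∀ n (x : ℝ), F n x = f n x)
    (hA : ValidAsymptotics s G A) (hAr : ∀ n (x : ℝ), A n x = a n x) (hY : IsYSolution s G A Y)
    (n : Fin N) : EqOn (Y n) (fun z => Complex.exp (A n z + F n z)) (closure (strip s)) := by
  choose h hhA hhexp hhBA using hY.asymptotics
  set D : Fin N → ℂ → ℂ := fun n z => h n z - A n z with hD
  have hreal : ∀ x : ℝ, (x : ℂ) ∈ closure (strip s) := fun x =>
    subset_closure (ofReal_mem_strip hs x)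
  have hDc : ∀ n, Continuous fun x : ℝ => D n x := fun n =>
    (hhBA n).1.2.comp_continuous Complex.continuous_ofReal hreal
  have hYD : ∀ n (x : ℝ), Y n x = Complex.exp (a n x + D n x) := fun n x => by
    rw [← hhexp n x (hreal x), ← hAr, hD]; congr 1; ring
  -- positivity of `Y` on the real line makes the imaginary part of `D` constant there
  have him : ∀ n, ∃ k : ℤ, ∀ x : ℝ,
      ((D n x).im : ℂ) * Complex.I = k * (2 * Real.pi * Complex.I) := by
    intro n
    refine exists_int_of_exp_eq_one ((Complex.continuous_ofReal.comp
      (Complex.continuous_im.comp (hDc n))).mul continuous_const) fun x => ?_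
    obtain ⟨r, hr, hYr⟩ := hY.positive n x
    have h1 : Complex.exp (a n x + D n x) =
        (Real.exp (a n x + (D n x).re) : ℂ) * Complex.exp ((D n x).im * Complex.I) := by
      rw [Complex.ofReal_exp, ← Complex.exp_add]
      congr 1
      push_cast
      linear_combination -Complex.re_add_im (D n x)
    have h2 : (Real.exp (a n x + (D n x).re) : ℂ) = r := by
      have h3 := congrArg norm (hYD n x)
      rw [hYr, h1, norm_mul, Complex.norm_exp_ofReal_mul_I, mul_one, Complex.norm_real,
        Complex.norm_real, Real.norm_of_nonneg hr.le, Real.norm_of_nonneg (Real.exp_pos _).le] at h3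
      rw [h3]
    have h4 := hYD n x
    rw [hYr, h1, h2] at h4
    have hr' : (r : ℂ) ≠ 0 := by exact_mod_cast hr.ne'
    exact mul_left_cancel₀ hr' (by rw [← h4, mul_one])
  choose k hk using him
  choose B hB using fun n => (hhBA n).2
  set g : Fin N → (ℝ →ᵇ ℝ) := fun n => BoundedContinuousFunction.ofNormedAddCommGroup
    (fun x : ℝ => (D n x).re) (Complex.continuous_re.comp (hDc n)) (B n)
    (fun x => (Complex.abs_re_le_norm _).trans (hB n x (hreal x))) with hg
  have hgD : ∀ n (x : ℝ), D n x = g n x + k n * (2 * Real.pi * Complex.I) := fun n x => by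
    rw [← hk n x]; exact (Complex.re_add_im _).symm
  have hYg : ∀ n (x : ℝ), Y n x = Complex.exp (a n x + g n x) := fun n x => by
    rw [hYD, hgD, ← add_assoc, Complex.exp_add _ (k n * _), Complex.exp_int_mul_two_pi_mul_I,
        mul_one]
  -- the logarithmic form of the Y-system holds up to a constant multiple of `2πi`
  have hbd : ∀ n, ∃ r : ℤ, ∀ x : ℝ, (logSource G a (fun n => g n) n x : ℂ) -
      (D n (x + Complex.I * s) + D n (x - Complex.I * s)) = r * (2 * Real.pi * Complex.I) := by
    intro n
    refine exists_int_of_exp_eq_one ?_ fun x => ?_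
    · refine (continuous_ofReal_logSource G ha (fun n => (g n).continuous) n).sub
        (Continuous.add ?_ ?_)
      · exact (hhBA n).1.2.comp_continuous (by fun_prop) (add_I_mul_mem_closure hs)
      · exact (hhBA n).1.2.comp_continuous (by fun_prop) (sub_I_mul_mem_closure hs)
    · have h1 := hY.ysystem n x
      simp only [hYg] at h1
      rw [prod_one_add_exp_cpow G a (fun n => g n), ← hhexp n _ (add_I_mul_mem_closure hs x),
        ← hhexp n _ (sub_I_mul_mem_closure hs x), ← Complex.exp_add] at h1
      have h2 := hA.linear n x
      simp only [hAr] at h2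
      rw [show (logSource G a (fun n => g n) n x : ℂ) -
        (D n (x + Complex.I * s) + D n (x - Complex.I * s)) =
        (∑ m, (G n m : ℂ) * a m x + logSource G a (fun n => g n) n x) -
        (h n (x + Complex.I * s) + h n (x - Complex.I * s)) by
          simp only [hD]; linear_combination h2, Complex.exp_sub, ← h1,
        div_self (Complex.exp_ne_zero _)]
  choose r hr using hbd
  obtain ⟨M, hM⟩ := exists_norm_bound g
  obtain ⟨B', hB'⟩ := exists_logSource_bound G hE hM
  have hgf : g = f := by
    refine hf g fun x n => ?_
    have h1 := eq_kconv_boundary hs (hhBA n) x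
    have h2 : ∀ y : ℝ, D n (y + Complex.I * s) + D n (y - Complex.I * s) =
        (logSource G a (fun n => g n) n y : ℂ) - r n * (2 * Real.pi * Complex.I) := fun y => by
      rw [← hr n y]; ring
    change D n x = kconv s (fun y => D n (y + Complex.I * s) + D n (y - Complex.I * s)) x at h1
    simp only [h2] at h1
    rw [kconv_sub hs (continuous_ofReal_logSource G ha (fun n => (g n).continuous) n).measurable
      measurable_const (hB' n) (fun _ => le_rfl)] at h1
    have h3 : kconv s (fun _ => (r n * (2 * Real.pi * Complex.I) : ℂ)) x =
        (r n * Real.pi : ℝ) * Complex.I := by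
      rw [kconv, integral_mul_const, integral_kernel_sub hs (ofReal_mem_strip hs x)]
      push_cast; ring
    rw [h3, kconv_ofReal hs] at h1
    rw [kconv_ofReal hs]
    -- comparison of real parts
    have h4 := congrArg Complex.re h1
    simp only [Complex.sub_re, Complex.re_ofReal_mul, Complex.I_re, mul_zero, sub_zero,
      Complex.ofReal_re] at h4
    rw [← h4]
    rfl
  -- `D` and `F + 2πi k` agree on the real line, hence on the closed strip
  have hmem : MemA s fun z => F n z + k n * (2 * Real.pi * Complex.I) :=
    DiffContOnCl.add_const (hF n).1 _
  have hDF := MemA.eqOn_closure hs (hhBA n).1 hmem fun x => by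
    rw [hFr, ← hgf]; exact hgD n x
  intro z hz
  have h1 : D n z = F n z + k n * (2 * Real.pi * Complex.I) := hDF hz
  have h2 : h n z = A n z + F n z + k n * (2 * Real.pi * Complex.I) := by
    simp only [hD] at h1
    linear_combination h1
  dsimp only
  rw [← hhexp n z hz, h2, Complex.exp_add _ (k n * _), Complex.exp_int_mul_two_pi_mul_I, mul_one]

end TBA

theorem mainTheorem2 (N : ℕ) (hN : 0 < N) (s : ℝ) (hs : 0 < s)
    (G : Matrix (Fin N) (Fin N) ℝ) (hG : TBA.MatLtTwo G) (hGnonneg : TBA.NonNegative G)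
    (hGirr : TBA.Irreducible G)
    (a : Fin N → ℝ → ℝ) (ha : ∀ n, Continuous (a n)) (ha_below : ∀ n, BddBelow (Set.range (a n)))
    (ha_holder : ∀ n, TBA.IsHolder (fun x => Real.exp (-a n x))) :
    ∃ fstar : Fin N → (ℝ →ᵇ ℝ),
      -- for every `C`, `fstar` is the unique solution; in particular it does not depend on `C`
      (∀ C : Matrix (Fin N) (Fin N) ℝ, TBA.MatLtTwo C →
        TBA.IsTBASolution s G C a (fun n => fstar n) ∧
        ∀ f : Fin N → (ℝ →ᵇ ℝ), TBA.IsTBASolution s G C a (fun n => f n) → f = fstar) ∧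
      -- analytic extension, and the associated solution of the Y-system
      ∃ F : Fin N → ℂ → ℂ,
        (∀ n, TBA.MemBA s (F n)) ∧ (∀ n (x : ℝ), F n x = fstar n x) ∧
        ∀ A : Fin N → ℂ → ℂ, TBA.ValidAsymptotics s G A → (∀ n (x : ℝ), A n x = a n x) →
          TBA.IsYSolution s G A (fun n z => Complex.exp (A n z + F n z)) ∧
          ∀ Y : Fin N → ℂ → ℂ, TBA.IsYSolution s G A Y →
            ∀ n, Set.EqOn (Y n) (fun z => Complex.exp (A n z + F n z)) (closure (TBA.strip s)) := by
  have hE : ∃ E : ℝ, ∀ n x, Real.exp (-a n x) ≤ E := by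
    choose b hb using ha_below
    refine ⟨∑ n, Real.exp (-b n), fun n x => ?_⟩
    have h1 : b n ≤ a n x := hb n (Set.mem_range_self x)
    refine (Real.exp_le_exp.2 (neg_le_neg h1)).trans ?_
    exact Finset.single_le_sum (f := fun n => Real.exp (-b n)) (fun i _ => (Real.exp_pos _).le)
      (Finset.mem_univ n)
  obtain ⟨E, hE⟩ := hE
  obtain ⟨fstar, hfstar⟩ := TBA.exists_unique_fixedPoint hs hG hGnonneg ha hE
  have hfix := (hfstar fstar).2 rfl
  obtain ⟨F, hF, hFr, hFb⟩ := TBA.exists_extension_of_fixedPoint hs ha hE ha_holder fstar hfix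
  refine ⟨fstar, fun C hC => ⟨(TBA.isTBASolution_iff hs hC ha hE fstar).2 hfix, fun f hf =>
    (hfstar f).1 ((TBA.isTBASolution_iff hs hC ha hE f).1 hf)⟩, F, hF, hFr, fun A hA hAr =>
    ⟨TBA.isYSolution_exp hF hFr hFb hA hAr, fun Y hY n => ?_⟩⟩
  exact TBA.IsYSolution.eqOn_exp hs ha hE (fun g => (hfstar g).1) hF hFr hA hAr hY n
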